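/- Let $d\mu(z)=\pi^{-1}e^{-|z|^2}\,d\lambda(z)$ be the normalized Gaussian measure on $\mathbb C$ ($\lambda$ Lebesgue measure), let $\mathcal F\subset L^2(\mathbb C,d\mu)$ be the Bargmann--Fock space, i.e. the closed subspace of (classes of) entire functions, and let $P:L^2(\mathbb C,d\mu)\to\mathcal F$ be the orthogonal projection. For a bounded Borel function $f$ on $\mathbb C$ let $T_f:\mathcal F\to\mathcal F$ be the Wick--Toeplitz operator $$(T_f\phi)(z)=\int_{\mathbb C}e^{z\bar w}f(w)\phi(w)\,d\mu(w).$$ For $\hbar>0$ put $\alpha_\hbar(f)(z)=f(\hbar z)$ and $Q^W_\hbar(f)=T_{\alpha_\hbar(f)}$. Let $\delta\mathbb C$ be the compactification of $\mathbb C$ by the circle at infinity (the closed unit disc, with $\mathbb C$ embedded radially onto the open disc by $z\mapsto z/\sqrt{1+|z|^2}$). Identify $C(\delta\mathbb C)$ with the algebra $C_\delta(\mathbb C)$ of the restrictions to $\mathbb C$ of the continuous functions on $\delta\mathbb C$, so that $C_0(\mathbb C)\subset C(\delta\mathbb C)$. Let $B(\mathcal F)$ and $K(\mathcal F)$ be the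 bounded and the compact operators on $\mathcal F$. Then $\{Q^W_\hbar\}_{\hbar\in(0,1]}$ is a relative positive asymptotic morphism $$\{Q^W_\hbar\}:(C(\delta\mathbb C),C_0(\mathbb C))\to(B(\mathcal F),K(\mathcal F)),$$ that is: each $Q^W_\hbar:C(\delta\mathbb C)\to B(\mathcal F)$ is linear and positive and maps $C_0(\mathbb C)$ into $K(\mathcal F)$; for each $f\in C(\delta\mathbb C)$ the map $\hbar\mapsto Q^W_\hbar(f)$ is norm continuous on $(0,1]$; and $\lim_{\hbar\to0}\|Q^W_\hbar(fg)-Q^W_\hbar(f)Q^W_\hbar(g)\|=0$ for all $f,g\in C(\delta\mathbb C)$. Its associated $C_\delta$-asymptotic spectral measure is $$A^W_\hbar(\Delta)=A^W(\hbar^{-1}\Delta)=P\circ\chi_{\hbar^{-1}\Delta}=P\circ\alpha_\hbar(\chi_\Delta)\qquad(\Delta\subset\mathbb C\text{ Borel}),$$ where $A^W(\Delta)=P\circ\chi_\Delta$ and functions act on $L^2(\mathbb C,d\mu)$ by multiplication. That is: for each $\hbar\in(0,1]$, $A^W_\hbar$ is a positive operator-valued measure on the Borel sets of $\mathbb C$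 (countably additive in the weak operator topology), $A^W_\hbar(U)\in K(\mathcal F)$ for every open $U$ with compact closure, and $Q^W_\hbar(f)=\int_{\mathbb C}f\,dA^W_\hbar$ in the weak sense for all $f\in C_\delta(\mathbb C)$; hence the integrals $f\mapsto\int f\,dA^W_\hbar$ form an asymptotic morphism on $C_\delta(\mathbb C)$. Moreover $\{A^W_\hbar\}$ is the only family of positive operator-valued measures with $Q^W_\hbar(f)=\int_{\mathbb C}f\,dA_\hbar$ for all $f\in C_\delta(\mathbb C)$ and $\hbar\in(0,1]$. -/

import Mathlib

open MeasureTheory Filter Topology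
open scoped ComplexOrder ComplexConjugate InnerProductSpace Pointwise

noncomputable section

namespace WickToeplitz

/-! ### The Gaussian measure, the Bergman kernel and the Fock space -/

/-- The normalized Gaussian measure `dμ(z) = π⁻¹ exp(-|z|²) dλ(z)` on `ℂ`. -/
def gaussian : Measure ℂ :=
  (volume : Measure ℂ).withDensity fun z => ENNReal.ofReal (Real.pi⁻¹ * Real.exp (-‖z‖ ^ 2))

/-- The Bergman kernel `k(z, w) = exp(z w̄)`. -/
def bergmanKernel (z w : ℂ) : ℂ := Complex.exp (z * conj w)

theorem integrable_gaussian_iff {E : Type*} [NormedAddCommGroup E] [NormedSpace ℝ E]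
    {g : ℂ → E} :
    Integrable g gaussian ↔
      Integrable (fun z => (Real.pi⁻¹ * Real.exp (-‖z‖ ^ 2)) • g z) volume := by
  unfold gaussian
  rw [integrable_withDensity_iff_integrable_smul₀' (by fun_prop) (by simp)]
  have : ∀ z : ℂ, (ENNReal.ofReal (Real.pi⁻¹ * Real.exp (-‖z‖ ^ 2))).toReal =
      Real.pi⁻¹ * Real.exp (-‖z‖ ^ 2) := fun z => ENNReal.toReal_ofReal (by positivity)
  simp only [this]

theorem integral_gaussian {E : Type*} [NormedAddCommGroup E] [NormedSpace ℝ E]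
    (g : ℂ → E) :
    ∫ z, g z ∂gaussian = ∫ z, (Real.pi⁻¹ * Real.exp (-‖z‖ ^ 2)) • g z := by
  unfold gaussian
  rw [integral_withDensity_eq_integral_toReal_smul (by fun_prop) (by simp)]
  have : ∀ z : ℂ, (ENNReal.ofReal (Real.pi⁻¹ * Real.exp (-‖z‖ ^ 2))).toReal =
      Real.pi⁻¹ * Real.exp (-‖z‖ ^ 2) := fun z => ENNReal.toReal_ofReal (by positivity)
  simp only [this]

theorem integrable_exp_neg_sq {b : ℝ} (hb : 0 < b) :
    Integrable (fun z : ℂ => Real.exp (-b * ‖z‖ ^ 2)) volume := by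
  have h := (GaussianFourier.integrable_cexp_neg_mul_sq_norm_add (b := (b : ℂ)) (V := ℂ)
    (by simpa using hb) 0 0).norm
  refine h.congr (ae_of_all _ fun z => ?_)
  simp only [Complex.norm_exp]
  congr 1
  simp [← Complex.ofReal_pow]

theorem memLp_exp (c : ℝ) : MemLp (fun w : ℂ => Real.exp (c * ‖w‖)) 2 gaussian := by
  rw [memLp_two_iff_integrable_sq_norm (by fun_prop), integrable_gaussian_iff]
  refine ((integrable_exp_neg_sq (b := 1 / 2) (by norm_num)).const_mul
    (Real.pi⁻¹ * Real.exp (2 * c ^ 2))).mono' (by fun_prop) (ae_of_all _ fun z => ?_)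
  rw [Real.norm_of_nonneg (by positivity), smul_eq_mul, Real.norm_of_nonneg (by positivity),
    mul_assoc, mul_assoc, ← Real.exp_nat_mul, ← Real.exp_add, ← Real.exp_add]
  refine mul_le_mul_of_nonneg_left (Real.exp_le_exp.2 ?_) (by positivity)
  push_cast
  nlinarith [sq_nonneg (2 * c - ‖z‖)]

theorem norm_bergmanKernel_le (z w : ℂ) : ‖bergmanKernel z w‖ ≤ Real.exp (‖z‖ * ‖w‖) := by
  unfold bergmanKernel
  rw [Complex.norm_exp]
  refine Real.exp_le_exp.2 ((Complex.re_le_norm _).trans ?_)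
  simp

theorem continuous_bergmanKernel (z : ℂ) : Continuous (bergmanKernel z) := by
  unfold bergmanKernel
  fun_prop

theorem memLp_bergmanKernel (z : ℂ) : MemLp (bergmanKernel z) 2 gaussian :=
  (memLp_exp ‖z‖).mono (continuous_bergmanKernel z).aestronglyMeasurable
    (ae_of_all _ fun w => (norm_bergmanKernel_le z w).trans (le_abs_self _))

/-- The Bergman kernel is the integral kernel of a map into entire functions. -/
theorem differentiable_bergmanIntegral {h : ℂ → ℂ} (hh : MemLp h 2 gaussian) :
    Differentiable ℂ fun z => ∫ w, bergmanKernel z w * h w ∂gaussian := by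
  intro z₀
  have hb : Integrable (fun w => Real.exp ((‖z₀‖ + 2) * ‖w‖) * ‖h w‖) gaussian :=
    (memLp_exp (‖z₀‖ + 2)).integrable_mul hh.norm
  have hd : ∀ w z : ℂ, HasDerivAt (fun z => bergmanKernel z w * h w)
      (bergmanKernel z w * conj w * h w) z := by
    intro w z
    have h1 := ((hasDerivAt_id z).mul_const (conj w)).cexp.mul_const (h w)
    simpa [bergmanKernel] using h1
  refine ((hasDerivAt_integral_of_dominated_loc_of_deriv_le (μ := gaussian)
    (F := fun z w => bergmanKernel z w * h w)
    (F' := fun z w => bergmanKernel z w * conj w * h w)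
    (bound := fun w => Real.exp ((‖z₀‖ + 2) * ‖w‖) * ‖h w‖)
    (Metric.ball_mem_nhds z₀ one_pos) ?_ ?_ ?_ ?_ hb ?_).2).differentiableAt
  · exact Eventually.of_forall fun z =>
      (continuous_bergmanKernel z).aestronglyMeasurable.mul hh.1
  · exact (memLp_bergmanKernel z₀).integrable_mul hh
  · exact ((continuous_bergmanKernel z₀).mul Complex.continuous_conj).aestronglyMeasurable.mul
      hh.1
  · refine ae_of_all _ fun w z hz => ?_
    rw [norm_mul, norm_mul, RCLike.norm_conj]
    gcongr
    have hz' : ‖z‖ ≤ ‖z₀‖ + 1 := by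
      have h1 := norm_sub_norm_le z z₀
      rw [mem_ball_iff_norm] at hz
      linarith
    have h2 : ‖w‖ ≤ Real.exp ‖w‖ := by linarith [Real.add_one_le_exp ‖w‖]
    calc ‖bergmanKernel z w‖ * ‖w‖ ≤ Real.exp (‖z‖ * ‖w‖) * Real.exp ‖w‖ := by
          gcongr
          exact norm_bergmanKernel_le z w
      _ = Real.exp ((‖z‖ + 1) * ‖w‖) := by rw [← Real.exp_add]; ring_nf
      _ ≤ _ := Real.exp_le_exp.2 (mul_le_mul_of_nonneg_right (by linarith) (norm_nonneg w))
  · exact ae_of_all _ fun w z _ => hd w z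

/-- Mean value property of entire functions with respect to the Gaussian measure. -/
theorem integral_gaussian_of_differentiable {g : ℂ → ℂ} (hg : Differentiable ℂ g)
    (hi : Integrable g gaussian) : ∫ z, g z ∂gaussian = g 0 := by
  have key : ∀ q : ℂ → ℂ, Differentiable ℂ q → Integrable q gaussian →
      ∫ z, q z ∂gaussian =
        (∫ r in Set.Ioi (0 : ℝ), r * (2 * Real.exp (-r ^ 2)) : ℝ) * q 0 := by
    intro q hq hqi
    rw [integrable_gaussian_iff] at hqi
    rw [integral_gaussian, ← Complex.integral_comp_polarCoord_symm]
    rw [polarCoord_target, Measure.volume_eq_prod, setIntegral_prod]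
    · rw [← integral_complex_ofReal, ← integral_mul_const]
      refine setIntegral_congr_fun measurableSet_Ioi fun r hr => ?_
      have hr : 0 < r := hr
      have hav : Real.circleAverage q 0 r = q 0 :=
        (hq.diffContOnCl (s := Metric.ball 0 |r|)).circleAverage
      rw [Real.circleAverage_eq_integral_add (-Real.pi),
        intervalIntegral.integral_comp_add_right (fun θ => q (circleMap 0 r θ)),
        show (0 : ℝ) + -Real.pi = -Real.pi by ring,
        show 2 * Real.pi + -Real.pi = Real.pi by ring,
        intervalIntegral.integral_of_le (by linarith [Real.pi_pos]),
        integral_Ioc_eq_integral_Ioo] at hav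
      have hc : ∀ θ : ℝ, r • (Real.pi⁻¹ * Real.exp (-‖Complex.polarCoord.symm (r, θ)‖ ^ 2)) •
          q (Complex.polarCoord.symm (r, θ)) =
          (r * (Real.pi⁻¹ * Real.exp (-r ^ 2))) • q (circleMap 0 r θ) := by
        intro θ
        rw [Complex.norm_polarCoord_symm, sq_abs, smul_smul, Complex.polarCoord_symm_apply]
        simp [circleMap, Complex.exp_mul_I]
      simp only [hc]
      rw [integral_smul, ← hav, Complex.real_smul, Complex.real_smul]
      push_cast
      field_simp
    · rw [← Measure.volume_eq_prod, ← polarCoord_target]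
      have hqc : Continuous q := hq.continuous
      have hm : Continuous fun p : ℝ × ℝ => Complex.polarCoord.symm p := by
        simp only [Complex.polarCoord_symm_apply]
        fun_prop
      refine ⟨?_, ?_⟩
      · have : Continuous fun p : ℝ × ℝ =>
            p.1 • (Real.pi⁻¹ * Real.exp (-‖Complex.polarCoord.symm p‖ ^ 2)) •
              q (Complex.polarCoord.symm p) := by fun_prop
        exact this.aestronglyMeasurable
      · have h2 := hqi.2
        rw [HasFiniteIntegral, ← Complex.lintegral_comp_polarCoord_symm] at h2
        rw [HasFiniteIntegral]
        refine lt_of_le_of_lt (le_of_eq ?_) h2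
        refine setLIntegral_congr_fun polarCoord.open_target.measurableSet fun p hp => ?_
        rw [polarCoord_target] at hp
        have hp1 : 0 < p.1 := hp.1
        rw [enorm_smul, Real.enorm_of_nonneg hp1.le, smul_eq_mul]
  have h0 : Integrable (fun _ : ℂ => (1 : ℂ)) gaussian := by
    rw [integrable_gaussian_iff]
    have := ((integrable_exp_neg_sq one_pos).const_mul Real.pi⁻¹).smul_const (1 : ℂ)
    simpa using this
  have h1 := key (fun _ => 1) (by fun_prop) h0
  have h2 : ∫ _z : ℂ, (1 : ℂ) ∂gaussian = 1 := by
    rw [integral_gaussian, integral_smul_const, integral_const_mul]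
    have := GaussianFourier.integral_rexp_neg_mul_sq_norm (V := ℂ) one_pos
    simp only [neg_mul, one_mul, Complex.finrank_real_complex] at this
    rw [this]
    simp [Real.pi_ne_zero]
  rw [h2, mul_one] at h1
  rw [key g hg hi, ← h1, one_mul]

/-- Reproducing property of the Bergman kernel. -/
theorem integral_bergmanKernel_mul {g : ℂ → ℂ} (hg : Differentiable ℂ g)
    (hm : MemLp g 2 gaussian) (z : ℂ) : ∫ w, bergmanKernel z w * g w ∂gaussian = g z := by
  have hi : Integrable (fun w => bergmanKernel z w * g w) gaussian :=
    (memLp_bergmanKernel z).integrable_mul hm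
  have hid : ∀ u : ℂ, (Real.pi⁻¹ * Real.exp (-‖u + z‖ ^ 2)) • (bergmanKernel z (u + z) * g (u + z))
      = (Real.pi⁻¹ * Real.exp (-‖u‖ ^ 2)) • (Complex.exp (-(conj z * u)) * g (u + z)) := by
    intro u
    have : (-‖u + z‖ ^ 2 : ℂ) + z * conj (u + z) = -‖u‖ ^ 2 + -(conj z * u) := by
      rw [← Complex.mul_conj', ← Complex.mul_conj', map_add]
      ring
    simp only [Complex.real_smul, bergmanKernel, Complex.ofReal_mul, Complex.ofReal_exp,
      Complex.ofReal_neg, Complex.ofReal_pow]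
    rw [mul_assoc, mul_assoc, ← mul_assoc (Complex.exp _) (Complex.exp _),
      ← mul_assoc (Complex.exp _) (Complex.exp _), ← Complex.exp_add, ← Complex.exp_add, this]
  have hi2 := hi
  rw [integrable_gaussian_iff] at hi2
  have hi3 := hi2.comp_add_right z
  simp only [hid] at hi3
  rw [← integrable_gaussian_iff (g := fun u => Complex.exp (-(conj z * u)) * g (u + z))] at hi3
  rw [integral_gaussian, ← integral_add_right_eq_self _ z]
  simp only [hid]
  rw [← integral_gaussian (fun u => Complex.exp (-(conj z * u)) * g (u + z)),
    integral_gaussian_of_differentiable (by fun_prop) hi3]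
  simp

/-- The Hilbert space `L²(ℂ, dμ)`. -/
abbrev L2Gaussian : Type := Lp ℂ 2 gaussian

/-- The (bosonic) Fock space: the subspace of `L²(ℂ, dμ)` of (classes of) analytic functions. -/
def fock : Submodule ℂ L2Gaussian where
  carrier := {φ | ∃ g : ℂ → ℂ, Differentiable ℂ g ∧ φ =ᵐ[gaussian] g}
  zero_mem' := ⟨0, differentiable_const 0, Lp.coeFn_zero ℂ 2 gaussian⟩
  add_mem' := by
    rintro φ ψ ⟨g, hg, hφ⟩ ⟨h, hh, hψ⟩
    exact ⟨g + h, hg.add hh, (Lp.coeFn_add φ ψ).trans (hφ.add hψ)⟩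
  smul_mem' := by
    rintro c φ ⟨g, hg, hφ⟩
    exact ⟨c • g, hg.const_smul c, (Lp.coeFn_smul c φ).trans (hφ.const_smul c)⟩

theorem integral_bergmanKernel_eq_inner (z : ℂ) (h : L2Gaussian) :
    ∫ w, bergmanKernel z w * h w ∂gaussian =
      ⟪((memLp_bergmanKernel z).star.toLp _ : L2Gaussian), h⟫_ℂ := by
  rw [L2.inner_def]
  refine integral_congr_ae ?_
  filter_upwards [MemLp.coeFn_toLp (memLp_bergmanKernel z).star] with w hw
  rw [hw]
  simp [mul_comm]

theorem fock_eq {φ : L2Gaussian} (hφ : φ ∈ fock) :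
    φ =ᵐ[gaussian] fun z => ∫ w, bergmanKernel z w * φ w ∂gaussian := by
  obtain ⟨g, hg, hφg⟩ := hφ
  have hm : MemLp g 2 gaussian := (memLp_congr_ae hφg).1 (Lp.memLp φ)
  filter_upwards [hφg] with z hz
  rw [hz, ← integral_bergmanKernel_mul hg hm z]
  refine integral_congr_ae ?_
  filter_upwards [hφg] with w hw
  rw [hw]

theorem isClosed_fock : IsClosed (fock : Set L2Gaussian) := by
  refine IsSeqClosed.isClosed fun u φ hu hφ => ?_
  refine ⟨_, differentiable_bergmanIntegral (Lp.memLp φ), ?_⟩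
  obtain ⟨ns, hns, hae⟩ := (tendstoInMeasure_of_tendsto_Lp hφ).exists_seq_tendsto_ae
  have hall : ∀ᵐ z ∂gaussian, ∀ n, u n z = ∫ w, bergmanKernel z w * u n w ∂gaussian :=
    ae_all_iff.2 fun n => fock_eq (hu n)
  filter_upwards [hae, hall] with z hz hz'
  refine tendsto_nhds_unique hz ?_
  simp only [hz', integral_bergmanKernel_eq_inner]
  exact (tendsto_const_nhds.inner hφ).comp hns.tendsto_atTop

instance : CompleteSpace fock := isClosed_fock.completeSpace_coe

/-- The orthogonal projection `P : L²(ℂ, dμ) → fock`. -/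
def proj : L2Gaussian →L[ℂ] fock := fock.orthogonalProjectionOnto

/-- The projection onto the Fock space is given by integration against the Bergman kernel. -/
theorem proj_eq (h : L2Gaussian) :
    (proj h : L2Gaussian) =ᵐ[gaussian] fun z => ∫ w, bergmanKernel z w * h w ∂gaussian := by
  have h1 := fock_eq (proj h).2
  filter_upwards [h1] with z hz
  rw [hz, integral_bergmanKernel_eq_inner, integral_bergmanKernel_eq_inner]
  have hk : ((memLp_bergmanKernel z).star.toLp _ : L2Gaussian) ∈ fock := by
    refine ⟨fun w => Complex.exp (conj z * w), by fun_prop, ?_⟩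
    filter_upwards [MemLp.coeFn_toLp (memLp_bergmanKernel z).star] with w hw
    rw [hw]
    simp [bergmanKernel, ← Complex.exp_conj]
  change ⟪_, fock.starProjection h⟫_ℂ = _
  rw [← Submodule.inner_starProjection_left_eq_right, Submodule.starProjection_eq_self_iff.2 hk]

/-! ### Bounded Borel functions, Toeplitz (Wick) operators -/

/-- The bounded Borel functions `B_b(ℂ)`. -/
structure BoundedBorel where
  /-- the underlying function -/
  toFun : ℂ → ℂ
  measurable : Measurable toFun
  bounded : ∃ C : ℝ, ∀ z, ‖toFun z‖ ≤ C

instance : CoeFun BoundedBorel fun _ => ℂ → ℂ := ⟨BoundedBorel.toFun⟩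

/-- The dilation `α_ħ(f)(z) = f(ħ z)`. -/
def dilate (ħ : ℝ) (f : BoundedBorel) : BoundedBorel where
  toFun z := f (ħ * z)
  measurable := f.measurable.comp (by fun_prop)
  bounded := f.bounded.imp fun _ hC z => hC _

/-- The characteristic function of a Borel set. -/
def borelIndicator (Δ : Set ℂ) (hΔ : MeasurableSet Δ) : BoundedBorel where
  toFun := Δ.indicator fun _ => 1
  measurable := measurable_const.indicator hΔ
  bounded := ⟨1, fun z => by by_cases h : z ∈ Δ <;> simp [h]⟩

theorem BoundedBorel.memLp_mul (f : BoundedBorel) (φ : L2Gaussian) :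
    MemLp (fun w => f w * φ w) 2 gaussian := by
  obtain ⟨C, hC⟩ := f.bounded
  refine (Lp.memLp φ).of_le_mul (c := C)
    (f.measurable.aestronglyMeasurable.mul (Lp.aestronglyMeasurable φ)) (ae_of_all _ fun w => ?_)
  rw [norm_mul]
  gcongr
  exact hC w

/-- The operator on `L²(ℂ, dμ)` of multiplication by a bounded Borel function. -/
def mulOp (f : BoundedBorel) : L2Gaussian →L[ℂ] L2Gaussian :=
  LinearMap.mkContinuous
    { toFun := fun φ => (f.memLp_mul φ).toLp _
      map_add' := fun φ ψ => by
        rw [← MemLp.toLp_add]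
        refine MemLp.toLp_congr _ _ ?_
        filter_upwards [Lp.coeFn_add φ ψ] with w hw
        simp only [Pi.add_apply, ← mul_add]
        exact congrArg (f w * ·) hw
      map_smul' := fun c φ => by
        rw [RingHom.id_apply, ← MemLp.toLp_const_smul]
        refine MemLp.toLp_congr _ _ ?_
        filter_upwards [Lp.coeFn_smul c φ] with w hw
        rw [hw]
        simp [mul_left_comm] }
    f.bounded.choose fun φ => by
      refine Lp.norm_le_mul_norm_of_ae_le_mul ?_
      filter_upwards [MemLp.coeFn_toLp (f.memLp_mul φ)] with w hw
      change ‖((f.memLp_mul φ).toLp _ : L2Gaussian) w‖ ≤ _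
      rw [hw, norm_mul]
      gcongr
      exact f.bounded.choose_spec w

theorem coeFn_mulOp (f : BoundedBorel) (φ : L2Gaussian) :
    mulOp f φ =ᵐ[gaussian] fun w => f w * φ w :=
  MemLp.coeFn_toLp (f.memLp_mul φ)

/-- The operator `P ∘ f` on the Fock space, `f` acting by multiplication on `L²(ℂ, dμ)`. -/
def compress (f : BoundedBorel) : fock →L[ℂ] fock :=
  proj ∘L mulOp f ∘L fock.subtypeL

/-- The function `T_f φ`, `(T_f φ)(z) = ∫ k(z, w) f(w) φ(w) dμ(w)`. -/
def wickFun (f : BoundedBorel) (φ : L2Gaussian) (z : ℂ) : ℂ :=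
  ∫ w, bergmanKernel z w * f w * φ w ∂gaussian

theorem differentiable_wickFun (f : BoundedBorel) (φ : L2Gaussian) :
    Differentiable ℂ (wickFun f φ) := by
  have h := differentiable_bergmanIntegral (f.memLp_mul φ)
  simp only [← mul_assoc] at h
  exact h

theorem wickFun_ae (f : BoundedBorel) (φ : fock) :
    wickFun f φ =ᵐ[gaussian] (compress f φ : L2Gaussian) := by
  filter_upwards [proj_eq (mulOp f φ)] with z hz
  change _ = (proj (mulOp f φ) : L2Gaussian) z
  rw [hz]
  refine integral_congr_ae ?_
  filter_upwards [coeFn_mulOp f φ] with w hw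
  rw [hw, mul_assoc]

theorem memLp_wickFun (f : BoundedBorel) (φ : fock) : MemLp (wickFun f φ) 2 gaussian :=
  (memLp_congr_ae (wickFun_ae f φ)).2 (Lp.memLp _)

theorem toLp_wickFun (f : BoundedBorel) (φ : fock) :
    (memLp_wickFun f φ).toLp _ = (compress f φ : L2Gaussian) := by
  refine Lp.ext ?_
  exact (MemLp.coeFn_toLp (memLp_wickFun f φ)).trans (wickFun_ae f φ)

/-- The Wick operator `T_f` of a bounded Borel function: the bounded operator on the Fock space
with `(T_f φ)(z) = ∫ k(z, w) f(w) φ(w) dμ(w)`. -/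
def wickOp (f : BoundedBorel) : fock →L[ℂ] fock :=
  LinearMap.mkContinuous
    { toFun := fun φ => ⟨(memLp_wickFun f φ).toLp _,
        wickFun f φ, differentiable_wickFun f φ, MemLp.coeFn_toLp _⟩
      map_add' := fun φ ψ => Subtype.ext <|
        (toLp_wickFun f (φ + ψ)).trans <|
          (congrArg Subtype.val (map_add (compress f) φ ψ)).trans
            (congrArg₂ (· + ·) (toLp_wickFun f φ).symm (toLp_wickFun f ψ).symm)
      map_smul' := fun c φ => Subtype.ext <|
        (toLp_wickFun f (c • φ)).trans <|
          (congrArg Subtype.val (map_smul (compress f) c φ)).trans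
            (congrArg (c • ·) (toLp_wickFun f φ).symm) }
    ‖compress f‖ fun φ => by
      have h : ‖((memLp_wickFun f φ).toLp _ : L2Gaussian)‖ ≤ ‖compress f‖ * ‖φ‖ := by
        rw [toLp_wickFun]
        exact (compress f).le_opNorm φ
      exact h

theorem wickOp_eq_compress (f : BoundedBorel) : wickOp f = compress f :=
  ContinuousLinearMap.ext fun φ => Subtype.ext (toLp_wickFun f φ)

/-! ### Asymptotic morphisms -/

section AsymptoticMorphism

variable {A B : Type*} [CStarAlgebra A] [PartialOrder A] [StarOrderedRing A]
  [CStarAlgebra B] [PartialOrder B] [StarOrderedRing B]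

/-- A positive asymptotic morphism between C*-algebras, parameterized by `ħ ∈ (0, 1]`
(values at other `ħ` are irrelevant). -/
structure IsPositiveAsymptoticMorphism (Q : ℝ → A →ₗ[ℂ] B) : Prop where
  positive : ∀ ħ ∈ Set.Ioc (0 : ℝ) 1, ∀ f : A, 0 ≤ f → 0 ≤ Q ħ f
  continuousOn : ∀ f : A, ContinuousOn (fun ħ => Q ħ f) (Set.Ioc (0 : ℝ) 1)
  tendsto_mul : ∀ f g : A,
    Tendsto (fun ħ => ‖Q ħ (f * g) - Q ħ f * Q ħ g‖) (𝓝[>] (0 : ℝ)) (𝓝 0)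

/-- A relative positive asymptotic morphism `(A, A₁) → (B, B₁)`. -/
structure IsRelativePositiveAsymptoticMorphism (Q : ℝ → A →ₗ[ℂ] B)
    (A₁ : NonUnitalSubalgebra ℂ A) (B₁ : NonUnitalSubalgebra ℂ B) : Prop extends
    IsPositiveAsymptoticMorphism Q where
  mem : ∀ ħ ∈ Set.Ioc (0 : ℝ) 1, ∀ f ∈ A₁, Q ħ f ∈ B₁

end AsymptoticMorphism

/-! ### Positive operator-valued measures -/

section POVM

variable {X : Type*} [MeasurableSpace X]
  {H : Type*} [NormedAddCommGroup H] [InnerProductSpace ℂ H]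

/-- Operator-valued functions of measurable sets. -/
abbrev OpSetFun (X : Type*) [MeasurableSpace X]
    (H : Type*) [NormedAddCommGroup H] [InnerProductSpace ℂ H] : Type _ :=
  ∀ Δ : Set X, MeasurableSet Δ → (H →L[ℂ] H)

/-- Positive operator-valued measures; countable additivity is in the weak operator topology. -/
structure IsPOVM (A : OpSetFun X H) : Prop where
  empty : A ∅ MeasurableSet.empty = 0
  nonneg : ∀ Δ hΔ, 0 ≤ A Δ hΔ
  hasSum : ∀ (Δ : ℕ → Set X) (hΔ : ∀ n, MeasurableSet (Δ n)), Pairwise (Function.onFun Disjoint Δ) →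
    ∀ v w : H, HasSum (fun n => ⟪v, A (Δ n) (hΔ n) w⟫_ℂ)
      ⟪v, A (⋃ n, Δ n) (MeasurableSet.iUnion hΔ) w⟫_ℂ

/-- For a POVM `A` and a vector `v`, the positive measure `Δ ↦ ⟨v, A(Δ) v⟩`. -/
def IsPOVM.diagMeasure {A : OpSetFun X H} (hA : IsPOVM A) (v : H) : Measure X :=
  Measure.ofMeasurable (fun Δ hΔ => ENNReal.ofReal (Complex.re ⟪v, A Δ hΔ v⟫_ℂ))
    (by simp [hA.empty])
    (fun Δ hΔ hd => by
      have h := Complex.hasSum_re (hA.hasSum Δ hΔ hd v v)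
      rw [← h.tsum_eq]
      refine ENNReal.ofReal_tsum_of_nonneg (fun n => ?_) h.summable
      have h0 := (ContinuousLinearMap.nonneg_iff_isPositive _).1 (hA.nonneg (Δ n) (hΔ n))
      exact h0.re_inner_nonneg_right v)

/-- `T = ∫ f dA` in the weak sense. (An operator on a complex space is determined by its quadratic
form, so by polarization it is enough to test against the measures `⟨v, A(·) v⟩`.) -/
def IsPOVM.IsIntegral {A : OpSetFun X H} (hA : IsPOVM A) (f : X → ℂ) (T : H →L[ℂ] H) : Prop :=
  ∀ v : H, ⟪v, T v⟫_ℂ = ∫ x, f x ∂hA.diagMeasure v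

/-- `{A_ħ}` is a family of POVMs on `X` with `Q_ħ(f) = ∫ f dA_ħ` for all continuous functions `f` on
the compactification `ι : X → K` and all `ħ ∈ (0, 1]`. -/
def Represents [TopologicalSpace X] {K : Type*} [TopologicalSpace K] (ι : C(X, K))
    (A : ℝ → OpSetFun X H) (Q : ℝ → C(K, ℂ) →ₗ[ℂ] (H →L[ℂ] H)) : Prop :=
  ∀ ħ ∈ Set.Ioc (0 : ℝ) 1, ∃ hA : IsPOVM (A ħ), ∀ f : C(K, ℂ), hA.IsIntegral (f ∘ ι) (Q ħ f)

/-- `C_δ`-asymptotic spectral measures, `C_δ(X) = C(K)` for a compactification `ι : X → K`: families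
of POVMs for which the integrals `Q_ħ(f) = ∫ f dA_ħ` form an asymptotic morphism on `C(K)`. -/
def IsCompactificationASM [CompleteSpace H] [TopologicalSpace X] {K : Type*} [TopologicalSpace K]
    [CompactSpace K] (ι : C(X, K)) (A : ℝ → OpSetFun X H) : Prop :=
  ∃ Q : ℝ → C(K, ℂ) →ₗ[ℂ] (H →L[ℂ] H), Represents ι A Q ∧ IsPositiveAsymptoticMorphism Q

/-- The algebra of compact operators. -/
def compactOperators (H : Type*) [NormedAddCommGroup H] [InnerProductSpace ℂ H] :
    NonUnitalSubalgebra ℂ (H →L[ℂ] H) where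
  carrier := {T | IsCompactOperator T}
  zero_mem' := isCompactOperator_zero
  add_mem' := fun hS hT => IsCompactOperator.add hS hT
  smul_mem' := fun c _ hT => IsCompactOperator.smul hT c
  mul_mem' := fun {_} {T} hS _ => IsCompactOperator.comp_clm hS T

/-- Locally `B`-valued families: `A_ħ(U) ∈ B` for all open `U` with compact closure. -/
def IsLocallyValued [TopologicalSpace X] [OpensMeasurableSpace X] (A : ℝ → OpSetFun X H)
    (B : NonUnitalSubalgebra ℂ (H →L[ℂ] H)) : Prop :=
  ∀ ħ ∈ Set.Ioc (0 : ℝ) 1, ∀ (U : Set X) (hU : IsOpen U), IsCompact (closure U) →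
    A ħ U hU.measurableSet ∈ B

end POVM

/-! ### The radial compactification of the plane -/

/-- The compactification `δℂ` of `ℂ` by the circle at infinity, realized as the closed unit disc
whose boundary is the circle at infinity. -/
abbrev RadialCompactification : Type := Metric.closedBall (0 : ℂ) 1

/-- The inclusion `ℂ → δℂ`, `z ↦ z / √(1 + |z|²)`. -/
def radialEmbedding : C(ℂ, RadialCompactification) where
  toFun z := ⟨Homeomorph.unitBall z, Metric.ball_subset_closedBall (Homeomorph.unitBall z).2⟩
  continuous_toFun := by fun_prop

theorem isOpenEmbedding_radialEmbedding : Topology.IsOpenEmbedding radialEmbedding := by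
  have h1 : Topology.IsOpenEmbedding
      (Set.inclusion (Metric.ball_subset_closedBall : Metric.ball (0 : ℂ) 1 ⊆ _)) := by
    refine ⟨Topology.IsEmbedding.inclusion _, ?_⟩
    rw [Set.range_inclusion]
    exact Metric.isOpen_ball.preimage continuous_subtype_val
  exact h1.comp Homeomorph.unitBall.isOpenEmbedding

theorem denseRange_radialEmbedding : DenseRange radialEmbedding := by
  intro p
  rw [closure_subtype]
  have h : Subtype.val '' Set.range radialEmbedding = Metric.ball (0 : ℂ) 1 := by
    rw [← Set.range_comp]
    refine Set.Subset.antisymm ?_ fun x hx => ?_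
    · rintro _ ⟨z, rfl⟩
      exact (Homeomorph.unitBall z).2
    · exact ⟨Homeomorph.unitBall.symm ⟨x, hx⟩, by simp [radialEmbedding]⟩
  rw [h, closure_ball _ one_ne_zero]
  exact p.2

/-- The extension of `f ∈ C_0(ℂ)` to `δℂ` by zero on the circle at infinity. -/
def extendByZero (f : ZeroAtInftyContinuousMap ℂ ℂ) : C(RadialCompactification, ℂ) where
  toFun := Function.extend radialEmbedding f 0
  continuous_toFun := by
    have hi := isOpenEmbedding_radialEmbedding
    rw [continuous_iff_continuousAt]
    intro p
    by_cases hp : p ∈ Set.range radialEmbedding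
    · obtain ⟨z, rfl⟩ := hp
      have hc : Function.extend radialEmbedding f 0 ∘ radialEmbedding = f :=
        funext fun z => hi.injective.extend_apply f 0 z
      rw [← hi.continuousAt_iff, hc]
      exact f.continuous.continuousAt
    · have hp0 : Function.extend radialEmbedding f 0 p = 0 :=
        Function.extend_apply' _ _ _ hp
      rw [ContinuousAt, hp0, Metric.tendsto_nhds]
      intro ε hε
      have hz := Metric.tendsto_nhds.1 (zero_at_infty f) ε hε
      obtain ⟨S, hS, hSs⟩ := mem_cocompact.1 hz
      have hcl : IsClosed (radialEmbedding '' S) := (hS.image radialEmbedding.continuous).isClosed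
      have hpS : p ∈ (radialEmbedding '' S)ᶜ := fun h => hp (Set.image_subset_range _ _ h)
      filter_upwards [hcl.isOpen_compl.mem_nhds hpS] with q hq
      by_cases hqr : q ∈ Set.range radialEmbedding
      · obtain ⟨z, rfl⟩ := hqr
        rw [hi.injective.extend_apply]
        exact hSs fun hz => hq ⟨z, hz, rfl⟩
      · rw [Function.extend_apply' _ _ _ hqr]
        simpa using hε

/-- The ideal `C_0(ℂ)` of `C(δℂ)`: the functions on `δℂ` whose restriction to `ℂ` vanishes at
infinity. -/
def zeroAtInfinity : NonUnitalSubalgebra ℂ C(RadialCompactification, ℂ) where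
  carrier := {F | ∃ f : ZeroAtInftyContinuousMap ℂ ℂ, ∀ z, F (radialEmbedding z) = f z}
  zero_mem' := ⟨0, fun _ => rfl⟩
  add_mem' := by
    rintro F G ⟨f, hf⟩ ⟨g, hg⟩
    exact ⟨f + g, fun z => by simp [hf, hg]⟩
  smul_mem' := by
    rintro c F ⟨f, hf⟩
    exact ⟨c • f, fun z => by simp [hf]⟩
  mul_mem' := by
    rintro F G ⟨f, hf⟩ ⟨g, hg⟩
    exact ⟨f * g, fun z => by simp [hf, hg]⟩

/-- Every function in `C_0(ℂ)` is the restriction of an element of `zeroAtInfinity`. -/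
theorem exists_mem_zeroAtInfinity (f : ZeroAtInftyContinuousMap ℂ ℂ) :
    ∃ F ∈ zeroAtInfinity, ∀ z, F (radialEmbedding z) = f z := by
  have h : ∀ z, extendByZero f (radialEmbedding z) = f z := fun z =>
    isOpenEmbedding_radialEmbedding.injective.extend_apply f 0 z
  exact ⟨extendByZero f, ⟨f, h⟩, h⟩

/-- The restriction to `ℂ` of a continuous function on `δℂ`. -/
def restrict (f : C(RadialCompactification, ℂ)) : BoundedBorel where
  toFun := f ∘ radialEmbedding
  measurable := (f.comp radialEmbedding).continuous.measurable
  bounded := ⟨‖f‖, fun _ => f.norm_coe_le_norm _⟩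

/-! ### The rescaled Wick quantization and its spectral measure -/

/-- The rescaled Wick-Toeplitz quantization `Q^W_ħ(f) = T_{f(ħ ·)}` on `C(δℂ)`. -/
def wickQuantization (ħ : ℝ) : C(RadialCompactification, ℂ) →ₗ[ℂ] (fock →L[ℂ] fock) where
  toFun f := wickOp (dilate ħ (restrict f))
  map_add' f g := by
    rw [wickOp_eq_compress, wickOp_eq_compress, wickOp_eq_compress, compress, compress, compress,
      ← ContinuousLinearMap.comp_add, ← ContinuousLinearMap.add_comp]
    congr 2
    ext1 φ
    refine Lp.ext ?_
    rw [add_apply]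
    filter_upwards [coeFn_mulOp (dilate ħ (restrict (f + g))) φ,
      coeFn_mulOp (dilate ħ (restrict f)) φ, coeFn_mulOp (dilate ħ (restrict g)) φ,
      Lp.coeFn_add (mulOp (dilate ħ (restrict f)) φ) (mulOp (dilate ħ (restrict g)) φ)]
      with w h1 h2 h3 h4
    rw [h1, h4, Pi.add_apply, h2, h3, ← add_mul]
    rfl
  map_smul' c f := by
    rw [wickOp_eq_compress, wickOp_eq_compress, compress, compress, RingHom.id_apply,
      ← ContinuousLinearMap.comp_smul, ← ContinuousLinearMap.smul_comp]
    congr 2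
    ext1 φ
    refine Lp.ext ?_
    rw [smul_apply]
    filter_upwards [coeFn_mulOp (dilate ħ (restrict (c • f))) φ,
      coeFn_mulOp (dilate ħ (restrict f)) φ, Lp.coeFn_smul c (mulOp (dilate ħ (restrict f)) φ)]
      with w h1 h2 h3
    rw [h1, h3, Pi.smul_apply, h2, smul_eq_mul, ← mul_assoc]
    rfl

/-- The POVM `A^W(Δ) = P ∘ χ_Δ`. -/
def wickPOVM : OpSetFun ℂ fock := fun Δ hΔ => compress (borelIndicator Δ hΔ)

/-- The rescaled family `A^W_ħ(Δ) = A^W(ħ⁻¹ Δ)`. -/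
def wickASM (ħ : ℝ) : OpSetFun ℂ fock := fun Δ hΔ =>
  wickPOVM (ħ⁻¹ • Δ) (hΔ.const_smul₀ ħ⁻¹)

end WickToeplitz

end

noncomputable section

namespace WickToeplitz

/-! ### Compressions of multiplication operators -/

/-! Both the quantization and the spectral measure are compressions `P ∘ f` of multiplication
operators (`wickQuantization_apply`, `wickASM_eq_compress`), and the quadratic form of a compression
is `⟨v, P f v⟩ = ∫ f |v|² dμ`. Positivity is immediate from this formula. It also shows that the
diagonal measures of `A^W_ħ` are the pushforwards of `|v|² dμ` under `z ↦ ħ z`, so the integral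
representation is a change of variables. Uniqueness holds because a finite measure on `ℂ` is
determined by its integrals against `C(δℂ)`, and an operator on a complex space by its quadratic
form.

Compactness comes from coherent states `k_w`: on the Fock space, `P ∘ f` is the mixture `∫ f(w)
|k_w⟩⟨k_w| dμ(w)`. For a symbol of bounded support this integral converges in operator norm, so it
stays in the closed space of compact operators; symbols vanishing at infinity are uniform limits of
these.

For asymptotic multiplicativity, `P f g - P f P g = P f (1 - P) g` on the Fock space, so only the
Hankel operator `(1 - P) g` matters. By the reproducing property its kernel is `k(z, w) (g(z) -
g(w))`. Conjugating by `exp(-|z|²/2)` turns `|k|` into a Gaussian in `z - w`, so a bound `|g(z) -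
g(w)| ≤ a + b |z - w|²` and Young's inequality give an operator norm linear in `a` and `b`
(`norm_mulOp_sub_proj_le`). A function on the compact disc is uniformly continuous and the embedding
of `ℂ` is Lipschitz, so the dilated symbol admits such a bound with `a` arbitrarily small and `b =
O(ħ²)`.

Norm continuity in `ħ` also uses uniform continuity: `s z` and `t z` are close in `δℂ` uniformly in
`z` when `t` is near `s > 0`. -/

instance : IsProbabilityMeasure gaussian where
  measure_univ := by
    have hi : Integrable (fun _ : ℂ => (1 : ℂ)) gaussian := by
      simpa using (memLp_exp 0).integrable_sq.ofReal (𝕜 := ℂ)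
    -- The mean value property of the constant function `1` computes the total mass.
    have h := integral_gaussian_of_differentiable (differentiable_const (1 : ℂ)) hi
    rw [integral_const, Complex.real_smul, mul_one] at h
    have h' : gaussian.real Set.univ = 1 := by exact_mod_cast h
    rw [Measure.real, ENNReal.toReal_eq_one_iff] at h'
    exact h'

/-- The projection is self-adjoint and fixes `v`, so it drops out of the inner product. -/
theorem inner_compress (f : BoundedBorel) (v w : fock) :
    ⟪v, compress f w⟫_ℂ =
      ∫ z, f z * (conj ((v : L2Gaussian) z) * (w : L2Gaussian) z) ∂gaussian := by
  change ⟪v, fock.orthogonalProjectionOnto (mulOp f w)⟫_ℂ = _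
  rw [Submodule.inner_orthogonalProjectionOnto_eq_of_mem_left, L2.inner_def]
  refine integral_congr_ae ?_
  filter_upwards [coeFn_mulOp f w] with z hz
  rw [hz, RCLike.inner_apply]
  ring

theorem integrable_conj_mul (v w : fock) :
    Integrable (fun z => conj ((v : L2Gaussian) z) * (w : L2Gaussian) z) gaussian :=
  (Lp.memLp (v : L2Gaussian)).star.integrable_mul (Lp.memLp (w : L2Gaussian))

theorem norm_proj_le (h : L2Gaussian) : ‖proj h‖ ≤ ‖h‖ :=
  fock.norm_orthogonalProjectionOnto_apply_le h

theorem norm_mulOp_le (f : BoundedBorel) {C : ℝ} (hC : ∀ z, ‖f z‖ ≤ C) (φ : L2Gaussian) :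
    ‖mulOp f φ‖ ≤ C * ‖φ‖ := by
  refine Lp.norm_le_mul_norm_of_ae_le_mul ?_
  filter_upwards [coeFn_mulOp f φ] with w hw
  rw [hw, norm_mul]
  gcongr
  exact hC w

theorem norm_compress_sub_le (f g : BoundedBorel) {C : ℝ} (hC : ∀ z, ‖f z - g z‖ ≤ C) :
    ‖compress f - compress g‖ ≤ C := by
  refine ContinuousLinearMap.opNorm_le_bound _ ((norm_nonneg _).trans (hC 0)) fun φ => ?_
  have h : (compress f - compress g) φ = proj (mulOp f φ - mulOp g φ) := (map_sub proj _ _).symm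
  rw [h]
  refine (norm_proj_le _).trans
    (Lp.norm_le_mul_norm_of_ae_le_mul (g := (φ : L2Gaussian)) ?_)
  filter_upwards [coeFn_mulOp f φ, coeFn_mulOp g φ,
    Lp.coeFn_sub (mulOp f φ) (mulOp g φ)] with w h1 h2 h3
  rw [h3, Pi.sub_apply, h1, h2, ← sub_mul, norm_mul]
  gcongr
  exact hC w

theorem inner_compress_self (f : BoundedBorel) (v : fock) :
    ⟪v, compress f v⟫_ℂ = ∫ z, f z * ((‖(v : L2Gaussian) z‖ ^ 2 : ℝ) : ℂ) ∂gaussian := by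
  rw [inner_compress]
  congr 1 with z
  rw [Complex.conj_mul']
  norm_cast

theorem compress_nonneg (f : BoundedBorel) (hf : ∀ z, 0 ≤ f z) : 0 ≤ compress f := by
  rw [ContinuousLinearMap.nonneg_iff_isPositive, ContinuousLinearMap.isPositive_iff_complex]
  intro v
  have h : 0 ≤ ⟪v, compress f v⟫_ℂ := by
    rw [inner_compress_self]
    refine integral_nonneg fun z => mul_nonneg (hf z) ?_
    exact Complex.zero_le_real.2 (sq_nonneg _)
  -- A nonnegative complex number is real, so conjugation, which swaps the two slots, leaves it
  -- unchanged.
  have h' : ⟪compress f v, v⟫_ℂ = ⟪v, compress f v⟫_ℂ := by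
    rw [← inner_conj_symm (compress f v) v,
      Complex.conj_eq_iff_im.2 (Complex.nonneg_iff.1 h).2.symm]
  rw [h']
  exact ⟨Complex.ext (by simp) (by simpa using (Complex.nonneg_iff.1 h).2), (Complex.nonneg_iff.1 h).1⟩

theorem wickQuantization_apply (ħ : ℝ) (f : C(RadialCompactification, ℂ)) :
    wickQuantization ħ f = compress (dilate ħ (restrict f)) :=
  wickOp_eq_compress _

/-! ### The spectral measures -/

theorem wickASM_eq_compress {ħ : ℝ} (hħ : ħ ≠ 0) (Δ : Set ℂ) (hΔ : MeasurableSet Δ) :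
    wickASM ħ Δ hΔ = compress (dilate ħ (borelIndicator Δ hΔ)) := by
  have h : borelIndicator (ħ⁻¹ • Δ) (hΔ.const_smul₀ ħ⁻¹) = dilate ħ (borelIndicator Δ hΔ) := by
    simp only [borelIndicator, dilate, BoundedBorel.mk.injEq]
    funext z
    have : z ∈ ħ⁻¹ • Δ ↔ (ħ : ℂ) * z ∈ Δ := by
      rw [Set.mem_inv_smul_set_iff₀ hħ, Complex.real_smul]
    by_cases hz : z ∈ ħ⁻¹ • Δ
    · rw [Set.indicator_of_mem hz, Set.indicator_of_mem (this.1 hz)]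
    · rw [Set.indicator_of_notMem hz, Set.indicator_of_notMem (mt this.2 hz)]
  change compress _ = _
  rw [h]

theorem measurable_ofReal_mul (ħ : ℝ) : Measurable fun z : ℂ => (ħ : ℂ) * z := by fun_prop

theorem inner_wickASM {ħ : ℝ} (hħ : ħ ≠ 0) (Δ : Set ℂ) (hΔ : MeasurableSet Δ) (v w : fock) :
    ⟪v, wickASM ħ Δ hΔ w⟫_ℂ = ∫ z in (fun z : ℂ => (ħ : ℂ) * z) ⁻¹' Δ,
      conj ((v : L2Gaussian) z) * (w : L2Gaussian) z ∂gaussian := by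
  rw [wickASM_eq_compress hħ, inner_compress, ← integral_indicator (measurable_ofReal_mul ħ hΔ)]
  congr 1 with z
  by_cases hz : (ħ : ℂ) * z ∈ Δ
  · rw [Set.indicator_of_mem (s := (fun z : ℂ => (ħ : ℂ) * z) ⁻¹' Δ) hz]
    simp [dilate, borelIndicator, hz]
  · rw [Set.indicator_of_notMem (s := (fun z : ℂ => (ħ : ℂ) * z) ⁻¹' Δ) hz]
    simp [dilate, borelIndicator, hz]

theorem isPOVM_wickASM {ħ : ℝ} (hħ : ħ ≠ 0) : IsPOVM (wickASM ħ) where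
  empty := by
    refine ContinuousLinearMap.ext fun w => ext_inner_left ℂ fun v => ?_
    rw [inner_wickASM hħ]
    simp
  nonneg Δ hΔ := by
    rw [wickASM_eq_compress hħ]
    refine compress_nonneg _ fun z => ?_
    by_cases hz : (ħ : ℂ) * z ∈ Δ <;> simp [dilate, borelIndicator, hz]
  hasSum Δ hΔ hd v w := by
    simp only [inner_wickASM hħ, Set.preimage_iUnion]
    exact hasSum_integral_iUnion (fun n => measurable_ofReal_mul ħ (hΔ n))
      (fun i j hij => (hd hij).preimage _) (integrable_conj_mul v w).integrableOn

theorem IsPOVM.diagMeasure_apply {X H : Type*} [MeasurableSpace X] [NormedAddCommGroup H]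
    [InnerProductSpace ℂ H] {A : OpSetFun X H} (hA : IsPOVM A) (v : H) (Δ : Set X)
    (hΔ : MeasurableSet Δ) :
    hA.diagMeasure v Δ = ENNReal.ofReal (Complex.re ⟪v, A Δ hΔ v⟫_ℂ) :=
  Measure.ofMeasurable_apply Δ hΔ

instance IsPOVM.isFiniteMeasure_diagMeasure {X H : Type*} [MeasurableSpace X]
    [NormedAddCommGroup H] [InnerProductSpace ℂ H] {A : OpSetFun X H} (hA : IsPOVM A) (v : H) :
    IsFiniteMeasure (hA.diagMeasure v) :=
  ⟨by rw [hA.diagMeasure_apply v _ MeasurableSet.univ]; exact ENNReal.ofReal_lt_top⟩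

/-- The measure with density `|v|²` with respect to the Gaussian measure. -/
def sqNormMeasure (v : fock) : Measure ℂ :=
  gaussian.withDensity fun z => ENNReal.ofReal (‖(v : L2Gaussian) z‖ ^ 2)

theorem diagMeasure_wickASM {ħ : ℝ} (hħ : ħ ≠ 0) (hA : IsPOVM (wickASM ħ)) (v : fock) :
    hA.diagMeasure v = (sqNormMeasure v).map fun z : ℂ => (ħ : ℂ) * z := by
  ext Δ hΔ
  have hm := measurable_ofReal_mul ħ
  have hi : Integrable (fun z => ‖(v : L2Gaussian) z‖ ^ 2) gaussian :=
    (Lp.memLp (v : L2Gaussian)).integrable_norm_pow (p := 2) (by norm_num)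
  rw [hA.diagMeasure_apply v Δ hΔ, Measure.map_apply hm hΔ, sqNormMeasure,
    withDensity_apply _ (hm hΔ), inner_wickASM hħ,
    ← ofReal_integral_eq_lintegral_ofReal hi.integrableOn (ae_of_all _ fun _ => sq_nonneg _)]
  congr 1
  rw [← Complex.ofReal_re (∫ z in _, _ ∂gaussian), ← integral_complex_ofReal]
  congr 2 with z
  rw [Complex.conj_mul']
  norm_cast

theorem integral_diagMeasure_wickASM {ħ : ℝ} (hħ : ħ ≠ 0) (hA : IsPOVM (wickASM ħ))
    (f : BoundedBorel) (v : fock) :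
    ∫ z, f z ∂hA.diagMeasure v = ⟪v, compress (dilate ħ f) v⟫_ℂ := by
  have hm := measurable_ofReal_mul ħ
  rw [diagMeasure_wickASM hħ, integral_map hm.aemeasurable f.measurable.aestronglyMeasurable,
    sqNormMeasure, integral_withDensity_eq_integral_toReal_smul₀ ?_ (by simp),
    inner_compress_self]
  · congr 1 with z
    rw [ENNReal.toReal_ofReal (sq_nonneg _), Complex.real_smul, mul_comm]
    rfl
  · exact ((Lp.aestronglyMeasurable (v : L2Gaussian)).norm.aemeasurable.pow_const 2).ennreal_ofReal

theorem represents_wickASM : Represents radialEmbedding wickASM wickQuantization := by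
  intro ħ hħ
  refine ⟨isPOVM_wickASM hħ.1.ne', fun f v => ?_⟩
  rw [wickQuantization_apply]
  exact (integral_diagMeasure_wickASM hħ.1.ne' _ (restrict f) v).symm

/-! ### Uniqueness of the representing measures -/

/-- Finite Borel measures on `K` are determined by their integrals against continuous functions.
This applies to the pushforwards along `ι`, and pulling back along the embedding recovers the
original measures. -/
theorem measure_ext_of_integral_comp {X K : Type*} [MeasurableSpace X] [TopologicalSpace K]
    [CompactSpace K] [HasOuterApproxClosed K] [MeasurableSpace K] [BorelSpace K] {ι : X → K}
    (hι : MeasurableEmbedding ι) {μ ν : Measure X} [IsFiniteMeasure μ] [IsFiniteMeasure ν]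
    (h : ∀ f : C(K, ℂ), ∫ x, f (ι x) ∂μ = ∫ x, f (ι x) ∂ν) : μ = ν := by
  rw [← hι.comap_map μ, ← hι.comap_map ν]
  congr 1
  refine ext_of_forall_integral_eq_of_IsFiniteMeasure fun f => ?_
  rw [hι.integral_map, hι.integral_map]
  have hf := h ⟨fun x => (f x : ℂ), by fun_prop⟩
  simp only [ContinuousMap.coe_mk] at hf
  rw [integral_complex_ofReal, integral_complex_ofReal] at hf
  exact_mod_cast hf

/-- Positivity makes `⟨v, A(Δ) v⟩` real and nonnegative, so taking the real part and then
`ENNReal.ofReal` in `diagMeasure` loses nothing; complex polarization does the rest. -/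
theorem IsPOVM.eq_of_diagMeasure_eq {X H : Type*} [MeasurableSpace X] [NormedAddCommGroup H]
    [InnerProductSpace ℂ H] {A B : OpSetFun X H} (hA : IsPOVM A) (hB : IsPOVM B)
    (h : ∀ v, hA.diagMeasure v = hB.diagMeasure v) (Δ : Set X) (hΔ : MeasurableSet Δ) :
    A Δ hΔ = B Δ hΔ := by
  have hpos : ∀ {C : OpSetFun X H} (hC : IsPOVM C), (C Δ hΔ).IsPositive := fun hC =>
    (ContinuousLinearMap.nonneg_iff_isPositive _).1 (hC.nonneg Δ hΔ)
  have hin : ∀ {C : OpSetFun X H} (hC : IsPOVM C) (v : H),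
      ⟪C Δ hΔ v, v⟫_ℂ = ((hC.diagMeasure v Δ).toReal : ℂ) := fun {C} hC v => by
    have hre : Complex.re ⟪v, C Δ hΔ v⟫_ℂ = Complex.re ⟪C Δ hΔ v, v⟫_ℂ :=
      inner_re_symm (𝕜 := ℂ) v (C Δ hΔ v)
    have h0 : 0 ≤ Complex.re ⟪v, C Δ hΔ v⟫_ℂ := (hpos hC).re_inner_nonneg_right v
    rw [hC.diagMeasure_apply v Δ hΔ, ENNReal.toReal_ofReal h0, hre]
    exact (((ContinuousLinearMap.isPositive_iff_complex _).1 (hpos hC) v).1).symm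
  refine ContinuousLinearMap.coe_injective ((ext_inner_map _ _).1 fun v => ?_)
  exact (hin hA v).trans ((congrArg (fun μ : Measure X => ((μ Δ).toReal : ℂ)) (h v)).trans
    (hin hB v).symm)

theorem Represents.eq {X K H : Type*} [MeasurableSpace X] [TopologicalSpace X] [TopologicalSpace K]
    [CompactSpace K] [HasOuterApproxClosed K] [MeasurableSpace K] [BorelSpace K]
    [NormedAddCommGroup H] [InnerProductSpace ℂ H] {ι : C(X, K)} (hι : MeasurableEmbedding ι)
    {A B : ℝ → OpSetFun X H} {Q : ℝ → C(K, ℂ) →ₗ[ℂ] (H →L[ℂ] H)} (hA : Represents ι A Q)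
    (hB : Represents ι B Q) {ħ : ℝ} (hħ : ħ ∈ Set.Ioc (0 : ℝ) 1) (Δ : Set X)
    (hΔ : MeasurableSet Δ) : A ħ Δ hΔ = B ħ Δ hΔ := by
  obtain ⟨hA', hAQ⟩ := hA ħ hħ
  obtain ⟨hB', hBQ⟩ := hB ħ hħ
  refine hA'.eq_of_diagMeasure_eq hB' (fun v => ?_) Δ hΔ
  exact measure_ext_of_integral_comp hι fun f => (hAQ f v).symm.trans (hBQ f v)

/-! ### Compactness of Toeplitz operators -/

/-- The coherent state `w ↦ exp(z̄ w)`, which reproduces the value at `z`. -/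
def coherentState (z : ℂ) : fock :=
  ⟨(memLp_bergmanKernel z).star.toLp _, fun w => Complex.exp (conj z * w), by fun_prop, by
    filter_upwards [MemLp.coeFn_toLp (memLp_bergmanKernel z).star] with w hw
    rw [hw]
    simp [bergmanKernel, ← Complex.exp_conj]⟩

theorem inner_coherentState (z : ℂ) (φ : fock) :
    ⟪coherentState z, φ⟫_ℂ = ∫ w, bergmanKernel z w * (φ : L2Gaussian) w ∂gaussian :=
  (integral_bergmanKernel_eq_inner z φ).symm

theorem inner_coherentState_ae (φ : fock) :
    ∀ᵐ z ∂gaussian, ⟪coherentState z, φ⟫_ℂ = (φ : L2Gaussian) z := by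
  filter_upwards [fock_eq φ.2] with z hz
  rw [inner_coherentState, hz]

theorem inner_coherentState_coherentState (z w : ℂ) :
    ⟪coherentState z, coherentState w⟫_ℂ = bergmanKernel z w := by
  have hae : (fun u => star (bergmanKernel w u)) = fun u => Complex.exp (conj w * u) := by
    funext u
    simp [bergmanKernel, ← Complex.exp_conj]
  have hm : MemLp (fun u => Complex.exp (conj w * u)) 2 gaussian :=
    hae ▸ (memLp_bergmanKernel w).star
  rw [inner_coherentState]
  have h := integral_bergmanKernel_mul (by fun_prop) hm z
  rw [bergmanKernel, mul_comm z, ← h]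
  refine integral_congr_ae ?_
  filter_upwards [MemLp.coeFn_toLp (memLp_bergmanKernel w).star] with u hu
  change _ * ((memLp_bergmanKernel w).star.toLp _ : L2Gaussian) u = _
  rw [hu]
  exact congrArg (bergmanKernel z u * ·) (congrFun hae u)

theorem norm_coherentState_sq (z : ℂ) : ‖coherentState z‖ ^ 2 = Real.exp (‖z‖ ^ 2) := by
  have h := inner_coherentState_coherentState z z
  rw [bergmanKernel, Complex.mul_conj'] at h
  have h2 : ((‖coherentState z‖ ^ 2 : ℝ) : ℂ) = ⟪coherentState z, coherentState z⟫_ℂ := by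
    rw [Complex.ofReal_pow]
    exact (inner_self_eq_norm_sq_to_K (𝕜 := ℂ) (coherentState z)).symm
  rw [h] at h2
  exact_mod_cast h2

/-- Expanding `‖k_z - k_w‖²` leaves only values of the Bergman kernel, which are continuous in `z`
and cancel at `z = w`. -/
theorem continuous_coherentState : Continuous coherentState := by
  rw [continuous_iff_continuousAt]
  intro w
  rw [ContinuousAt, tendsto_iff_norm_sub_tendsto_zero]
  have hc : Continuous fun z => Real.exp (‖z‖ ^ 2) -
      2 * Complex.re (bergmanKernel z w) + Real.exp (‖w‖ ^ 2) := by
    unfold bergmanKernel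
    fun_prop
  have h := (hc.tendsto w).sqrt
  have h0 : Real.exp (‖w‖ ^ 2) - 2 * Complex.re (bergmanKernel w w) + Real.exp (‖w‖ ^ 2) = 0 := by
    have : bergmanKernel w w = (Real.exp (‖w‖ ^ 2) : ℝ) := by
      rw [bergmanKernel, Complex.mul_conj']
      push_cast
      rfl
    rw [this, Complex.ofReal_re]
    ring
  rw [h0, Real.sqrt_zero] at h
  refine h.congr fun z => ?_
  rw [← Real.sqrt_sq (norm_nonneg (coherentState z - coherentState w)), norm_sub_sq (𝕜 := ℂ),
    inner_coherentState_coherentState, norm_coherentState_sq, norm_coherentState_sq]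
  rfl

/-! ### Compact operators as norm limits and as integrals of rank one operators. -/

theorem isCompactOperator_rankOne {H : Type*} [NormedAddCommGroup H] [InnerProductSpace ℂ H]
    (x y : H) : IsCompactOperator (InnerProductSpace.rankOne ℂ x y) := by
  have h : IsCompactOperator (ContinuousLinearMap.toSpanSingleton ℂ x) :=
    isCompactOperator_of_locallyCompactSpace_rng _
  exact h.comp_clm (innerSL ℂ y)

theorem isClosed_compactOperators {H : Type*} [NormedAddCommGroup H] [InnerProductSpace ℂ H]
    [CompleteSpace H] : IsClosed (compactOperators H : Set (H →L[ℂ] H)) :=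
  isClosed_setOfPred_isCompactOperator

theorem mem_compactOperators_of_forall_norm_sub_lt {H : Type*} [NormedAddCommGroup H]
    [InnerProductSpace ℂ H] [CompleteSpace H] {T : H →L[ℂ] H}
    (h : ∀ ε > 0, ∃ S ∈ compactOperators H, ‖T - S‖ < ε) : T ∈ compactOperators H := by
  have hT : T ∈ closure (compactOperators H : Set (H →L[ℂ] H)) :=
    Metric.mem_closure_iff.2 fun ε hε => by
      simp only [dist_eq_norm]
      exact h ε hε
  rwa [isClosed_compactOperators.closure_eq] at hT

/-- A bounded mixture of rank one operators is compact. -/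
theorem exists_compactOperator_inner_eq_integral {X H : Type*} [TopologicalSpace X]
    [SecondCountableTopology X] [MeasurableSpace X] [BorelSpace X] (μ : Measure X)
    [IsProbabilityMeasure μ] [NormedAddCommGroup H] [InnerProductSpace ℂ H] [CompleteSpace H]
    {k : X → H} (hk : Continuous k) {f : X → ℂ} (hf : Measurable f) {C : ℝ}
    (hC : ∀ x, ‖f x‖ * ‖k x‖ ^ 2 ≤ C) :
    ∃ S ∈ compactOperators H, ∀ v w : H,
      ⟪v, S w⟫_ℂ = ∫ x, f x * (⟪v, k x⟫_ℂ * ⟪k x, w⟫_ℂ) ∂μ := by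
  -- Continuity in operator norm supplies the strong measurability needed for a Bochner integral of
  -- operators.
  have hc : Continuous fun x => InnerProductSpace.rankOne ℂ (k x) (k x) :=
    (((ContinuousLinearMap.smulRightL ℂ H H).continuous.comp
      ((innerSL ℂ).continuous.comp hk)).clm_apply hk).congr fun x => by
        ext w
        simp [InnerProductSpace.rankOne_apply]
  have hi : Integrable (fun x => f x • InnerProductSpace.rankOne ℂ (k x) (k x)) μ := by
    refine Integrable.of_bound (hf.aestronglyMeasurable.smul hc.aestronglyMeasurable) C
      (ae_of_all _ fun x => ?_)
    rw [norm_smul, InnerProductSpace.norm_rankOne, ← sq]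
    exact hC x
  refine ⟨∫ x, f x • InnerProductSpace.rankOne ℂ (k x) (k x) ∂μ, ?_, fun v w => ?_⟩
  -- The average of a function with values in a closed convex set, against a probability measure,
  -- stays in the set.
  · have hconv : Convex ℝ (compactOperators H : Set (H →L[ℂ] H)) := by
      intro S hS T hT a b _ _ _
      have h : ∀ (c : ℝ) (U : H →L[ℂ] H), U ∈ compactOperators H → c • U ∈ compactOperators H :=
        fun c U hU => (compactOperators H).smul_mem (c : ℂ) hU
      exact add_mem (h a S hS) (h b T hT)
    exact hconv.integral_mem isClosed_compactOperators (ae_of_all _ fun x =>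
      (compactOperators H).smul_mem (f x) (isCompactOperator_rankOne _ _)) hi
  · rw [ContinuousLinearMap.integral_apply hi, ← integral_inner (hi.apply_continuousLinearMap w)]
    congr 1 with x
    rw [smul_apply, InnerProductSpace.rankOne_apply, inner_smul_right, inner_smul_right]
    ring

/-- Since `⟨k_w, φ⟩ = φ(w)` almost everywhere, the compression is the mixture of the projections
`|k_w⟩⟨k_w|` with weight `f(w)`. The norm `‖k_w‖² = exp(|w|²)` is at most `exp(R²)` where `f` can be
nonzero. -/
theorem compress_mem_of_bounded_support (f : BoundedBorel) {R : ℝ}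
    (hR : ∀ z, R < ‖z‖ → f z = 0) : compress f ∈ compactOperators fock := by
  obtain ⟨C, hC⟩ := f.bounded
  have hC0 : 0 ≤ C := (norm_nonneg _).trans (hC 0)
  obtain ⟨S, hS, hSf⟩ := exists_compactOperator_inner_eq_integral gaussian
    continuous_coherentState f.measurable (C := C * Real.exp (R ^ 2)) fun w => by
      by_cases hw : R < ‖w‖
      · rw [hR w hw, norm_zero, zero_mul]
        positivity
      · rw [norm_coherentState_sq]
        have := not_lt.1 hw
        gcongr
        exact hC w
  convert hS
  refine ContinuousLinearMap.ext fun φ => ext_inner_left ℂ fun v => ?_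
  rw [inner_compress, hSf]
  refine integral_congr_ae ?_
  filter_upwards [inner_coherentState_ae v, inner_coherentState_ae φ] with w h1 h2
  rw [h2, ← inner_conj_symm v, h1]

/-- The product of a bounded Borel function with the indicator of the ball of radius `R`. -/
def truncate (R : ℝ) (f : BoundedBorel) : BoundedBorel where
  toFun := (Metric.closedBall 0 R).indicator f
  measurable := f.measurable.indicator Metric.isClosed_closedBall.measurableSet
  bounded := f.bounded.imp fun _ hC z => (norm_indicator_le_norm_self f z).trans (hC z)

/-- Cutting `f` off outside a large ball changes it little in sup norm, hence changes its
compression little in operator norm. -/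
theorem compress_mem_of_tendsto_zero (f : BoundedBorel)
    (hf : Tendsto f (cocompact ℂ) (𝓝 0)) : compress f ∈ compactOperators fock := by
  refine mem_compactOperators_of_forall_norm_sub_lt fun ε hε => ?_
  have h := Metric.tendsto_nhds.1 hf (ε / 2) (half_pos hε)
  obtain ⟨S, hS, hSs⟩ := mem_cocompact.1 h
  obtain ⟨R, hR⟩ := hS.isBounded.subset_closedBall 0
  refine ⟨compress (truncate R f), compress_mem_of_bounded_support _ (R := R) fun z hz => ?_, ?_⟩
  · exact Set.indicator_of_notMem (by simpa using hz) _
  · refine (norm_compress_sub_le _ _ fun z => ?_).trans_lt (half_lt_self hε)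
    by_cases hz : z ∈ Metric.closedBall (0 : ℂ) R
    · simpa [truncate, Set.indicator_of_mem hz] using (half_pos hε).le
    · have : dist (f z) 0 < ε / 2 := hSs fun hzS => hz (hR hzS)
      simp only [truncate, Set.indicator_of_notMem hz, sub_zero]
      simpa only [dist_zero_right] using this.le

theorem isLocallyValued_wickASM : IsLocallyValued wickASM (compactOperators fock) := by
  intro ħ hħ U hU hUc
  rw [wickASM_eq_compress hħ.1.ne']
  obtain ⟨R, hR⟩ := hUc.isBounded.subset_closedBall 0
  refine compress_mem_of_bounded_support _ (R := R / ħ) fun z hz => ?_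
  rw [div_lt_iff₀ hħ.1] at hz
  change Set.indicator U (fun _ => (1 : ℂ)) (ħ * z) = 0
  refine Set.indicator_of_notMem (fun hz' => ?_) _
  have := hR (subset_closure hz')
  rw [mem_closedBall_zero_iff, norm_mul, Complex.norm_real, Real.norm_of_nonneg hħ.1.le] at this
  linarith

theorem wickQuantization_mem {ħ : ℝ} (hħ : 0 < ħ) {f : C(RadialCompactification, ℂ)}
    (hf : f ∈ zeroAtInfinity) : wickQuantization ħ f ∈ compactOperators fock := by
  rw [wickQuantization_apply]
  obtain ⟨g, hg⟩ := hf
  refine compress_mem_of_tendsto_zero _ ?_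
  have h0 : (dilate ħ (restrict f) : ℂ → ℂ) = fun z => g (ħ * z) := funext fun z => hg _
  rw [h0]
  have hc : (ħ : ℂ) ≠ 0 := by exact_mod_cast hħ.ne'
  exact Tendsto.comp (zero_at_infty g)
    (Homeomorph.mulLeft₀ (ħ : ℂ) hc).isClosedEmbedding.tendsto_cocompact

/-! ### Hankel operators with slowly oscillating symbols -/

open scoped ENNReal in
/-- Young's inequality for convolution of an integrable and a square integrable function. -/
theorem lintegral_convolution_sq_le {G : Type*} [AddCommGroup G] [MeasurableSpace G]
    [MeasurableAdd₂ G] [MeasurableNeg G] (μ : Measure G) [SFinite μ] [μ.IsAddLeftInvariant]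
    [μ.IsNegInvariant] {κ Φ : G → ℝ≥0∞} (hκ : Measurable κ) (hΦ : Measurable Φ) :
    ∫⁻ z, (∫⁻ w, κ (z - w) * Φ w ∂μ) ^ 2 ∂μ ≤ (∫⁻ u, κ u ∂μ) ^ 2 * ∫⁻ w, Φ w ^ 2 ∂μ := by
  have hκ2 : Measurable fun p : G × G => κ (p.1 - p.2) := hκ.comp measurable_sub
  -- Cauchy–Schwarz for the splitting `κ Φ = κ^(1/2) · (κ Φ²)^(1/2)`; Tonelli and translation
  -- invariance then finish the proof.
  have hcs : ∀ z, (∫⁻ w, κ (z - w) * Φ w ∂μ) ^ 2 ≤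
      (∫⁻ u, κ u ∂μ) * ∫⁻ w, κ (z - w) * Φ w ^ 2 ∂μ := by
    intro z
    have hz : Measurable fun w => κ (z - w) := hκ.comp (measurable_const.sub measurable_id)
    have h := ENNReal.lintegral_mul_norm_pow_le (μ := μ) hz.aemeasurable
      (hz.mul (hΦ.pow_const 2)).aemeasurable (p := 1 / 2) (q := 1 / 2)
      (by norm_num) (by norm_num) (by norm_num)
    have hpt : ∀ w, κ (z - w) ^ (1 / 2 : ℝ) * ((fun w => κ (z - w)) * fun w => Φ w ^ 2) w ^ (1 / 2 : ℝ)
        = κ (z - w) * Φ w := by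
      intro w
      rw [Pi.mul_apply, ENNReal.mul_rpow_of_nonneg _ _ (by norm_num), ← mul_assoc,
        ← ENNReal.rpow_add_of_nonneg _ _ (by norm_num) (by norm_num), ← ENNReal.rpow_natCast,
        ← ENNReal.rpow_mul]
      norm_num
    simp only [hpt] at h
    rw [lintegral_sub_left_eq_self κ z] at h
    have h2 := pow_le_pow_left' h 2
    rw [mul_pow, ← ENNReal.rpow_natCast, ← ENNReal.rpow_natCast, ← ENNReal.rpow_natCast,
      ← ENNReal.rpow_mul, ← ENNReal.rpow_mul] at h2
    norm_num at h2
    exact h2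
  calc ∫⁻ z, (∫⁻ w, κ (z - w) * Φ w ∂μ) ^ 2 ∂μ
      ≤ ∫⁻ z, (∫⁻ u, κ u ∂μ) * ∫⁻ w, κ (z - w) * Φ w ^ 2 ∂μ ∂μ := lintegral_mono hcs
    _ = (∫⁻ u, κ u ∂μ) * ∫⁻ z, ∫⁻ w, κ (z - w) * Φ w ^ 2 ∂μ ∂μ := by
        refine lintegral_const_mul _ ?_
        exact (hκ2.mul ((hΦ.comp measurable_snd).pow_const 2)).lintegral_prod_right'
    _ = (∫⁻ u, κ u ∂μ) * ∫⁻ w, ∫⁻ z, κ (z - w) * Φ w ^ 2 ∂μ ∂μ := by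
        rw [lintegral_lintegral_swap]
        exact (hκ2.mul ((hΦ.comp measurable_snd).pow_const 2)).aemeasurable
    _ = (∫⁻ u, κ u ∂μ) * ∫⁻ w, (∫⁻ u, κ u ∂μ) * Φ w ^ 2 ∂μ := by
        congr 2 with w
        rw [lintegral_mul_const _ (by exact hκ.comp (measurable_id.sub_const w)),
          lintegral_sub_right_eq_self κ w]
    _ = _ := by rw [lintegral_const_mul _ (hΦ.pow_const 2), sq, mul_assoc]

/-! ### Gaussian weights and the norm estimate for Hankel operators. -/

theorem lintegral_gaussian {g : ℂ → ENNReal} (hg : Measurable g) :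
    ∫⁻ z, g z ∂gaussian =
      ∫⁻ z, ENNReal.ofReal (Real.pi⁻¹ * Real.exp (-‖z‖ ^ 2)) * g z := by
  unfold gaussian
  rw [lintegral_withDensity_eq_lintegral_mul _ (by fun_prop) hg]
  rfl

/-- Completing the square: `|k(z, w)| = exp(Re z w̄)` and `|z - w|² = |z|² + |w|² - 2 Re z w̄`. The
symmetric weight makes the kernel translation invariant in modulus. -/
theorem norm_bergmanKernel_mul_exp (z w : ℂ) :
    Real.exp (-‖z‖ ^ 2 / 2) * (‖bergmanKernel z w‖ * Real.exp (-‖w‖ ^ 2)) =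
      Real.exp (-‖z - w‖ ^ 2 / 2) * Real.exp (-‖w‖ ^ 2 / 2) := by
  rw [bergmanKernel, Complex.norm_exp, ← Real.exp_add, ← Real.exp_add, ← Real.exp_add]
  congr 1
  simp only [← Complex.normSq_eq_norm_sq, Complex.normSq_apply, Complex.mul_re, Complex.sub_re,
    Complex.sub_im, Complex.conj_re, Complex.conj_im]
  ring

/-- The convolution kernel dominating the Hankel operator of a symbol `g` with
`|g(z) - g(w)| ≤ a + b |z - w|²`. -/
def hankelKernel (a b : ℝ) (u : ℂ) : ℝ :=
  Real.pi⁻¹ * (a + b * ‖u‖ ^ 2) * Real.exp (-‖u‖ ^ 2 / 2)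

theorem continuous_hankelKernel (a b : ℝ) : Continuous (hankelKernel a b) := by
  unfold hankelKernel
  fun_prop

theorem hankelKernel_nonneg {a b : ℝ} (ha : 0 ≤ a) (hb : 0 ≤ b) (u : ℂ) :
    0 ≤ hankelKernel a b u := by
  unfold hankelKernel
  positivity

theorem integrable_hankelKernel (a b : ℝ) : Integrable (hankelKernel a b) volume := by
  have h1 := integrable_exp_neg_sq (b := 1 / 2) (by norm_num)
  have h2 : Integrable (fun u : ℂ => ‖u‖ ^ 2 * Real.exp (-(1 / 2) * ‖u‖ ^ 2)) volume := by
    refine ((integrable_exp_neg_sq (b := 1 / 4) (by norm_num)).const_mul 4).mono'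
      (by fun_prop) (ae_of_all _ fun u => ?_)
    rw [Real.norm_of_nonneg (by positivity)]
    -- Half of the Gaussian exponent `1/2` absorbs the quadratic factor, leaving `1/4`.
    have h3 : ‖u‖ ^ 2 ≤ 4 * Real.exp (‖u‖ ^ 2 / 4) := by
      linarith [Real.add_one_le_exp (‖u‖ ^ 2 / 4)]
    calc ‖u‖ ^ 2 * Real.exp (-(1 / 2) * ‖u‖ ^ 2)
        ≤ 4 * Real.exp (‖u‖ ^ 2 / 4) * Real.exp (-(1 / 2) * ‖u‖ ^ 2) := by gcongr
      _ = 4 * Real.exp (-(1 / 4) * ‖u‖ ^ 2) := by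
        rw [mul_assoc, ← Real.exp_add]
        ring_nf
  refine ((h1.const_mul (Real.pi⁻¹ * a)).add (h2.const_mul (Real.pi⁻¹ * b))).congr
    (ae_of_all _ fun u => ?_)
  simp only [Pi.add_apply, hankelKernel, show -(1 / 2) * ‖u‖ ^ 2 = -‖u‖ ^ 2 / 2 by ring]
  ring

/-- Separates the two parameters, so that `a` can be fixed small before `b` is sent to `0`. -/
theorem integral_hankelKernel (a b : ℝ) :
    ∫ u, hankelKernel a b u = a * (∫ u, hankelKernel 1 0 u) + b * ∫ u, hankelKernel 0 1 u := by
  rw [← integral_const_mul, ← integral_const_mul, ← integral_add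
    ((integrable_hankelKernel 1 0).const_mul a) ((integrable_hankelKernel 0 1).const_mul b)]
  congr 1 with u
  simp only [hankelKernel]
  ring

/-- The reproducing property writes `g(z) φ(z)` as `∫ k(z, w) g(z) φ(w) dμ(w)`, from which the
integral formula for `P (g φ)` is subtracted. -/
theorem mulOp_sub_proj_ae (g : BoundedBorel) (φ : fock) :
    ∀ᵐ z ∂gaussian, (mulOp g φ - proj (mulOp g φ) : L2Gaussian) z =
      ∫ w, bergmanKernel z w * ((g z - g w) * (φ : L2Gaussian) w) ∂gaussian := by
  filter_upwards [Lp.coeFn_sub (mulOp g φ) (proj (mulOp g φ) : L2Gaussian),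
    coeFn_mulOp g φ, proj_eq (mulOp g φ), fock_eq φ.2] with z h1 h2 h3 h4
  have h5 : ∫ w, bergmanKernel z w * mulOp g φ w ∂gaussian =
      ∫ w, bergmanKernel z w * (g w * (φ : L2Gaussian) w) ∂gaussian := by
    refine integral_congr_ae ?_
    filter_upwards [coeFn_mulOp g φ] with w hw
    rw [hw]
  rw [h1, Pi.sub_apply, h2, h3, h4, h5, ← integral_const_mul, ← integral_sub]
  · congr 1 with w
    ring
  · exact ((memLp_bergmanKernel z).integrable_mul (Lp.memLp (φ : L2Gaussian))).const_mul (g z)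
  · exact (memLp_bergmanKernel z).integrable_mul (g.memLp_mul φ)

theorem enorm_bergman_integral_le (g : BoundedBorel) {a b : ℝ}
    (hg : ∀ z w, ‖g z - g w‖ ≤ a + b * ‖z - w‖ ^ 2) {φ : ℂ → ℂ} (hφ : Measurable φ) (z : ℂ) :
    ENNReal.ofReal (Real.exp (-‖z‖ ^ 2 / 2)) *
      ‖∫ w, bergmanKernel z w * ((g z - g w) * φ w) ∂gaussian‖ₑ ≤
      ∫⁻ w, ENNReal.ofReal (hankelKernel a b (z - w)) *
        (ENNReal.ofReal (Real.exp (-‖w‖ ^ 2 / 2)) * ‖φ w‖ₑ) := by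
  have hm : Measurable fun w => ‖bergmanKernel z w * ((g z - g w) * φ w)‖ₑ :=
    ((continuous_bergmanKernel z).measurable.mul
      ((measurable_const.sub g.measurable).mul hφ)).enorm
  refine (mul_le_mul_right (enorm_integral_le_lintegral_enorm _) _).trans ?_
  rw [lintegral_gaussian hm, ← lintegral_const_mul _ (by fun_prop)]
  refine lintegral_mono fun w => ?_
  simp only [← ofReal_norm]
  rw [← ENNReal.ofReal_mul (by positivity), ← ENNReal.ofReal_mul (by positivity),
    ← ENNReal.ofReal_mul (by positivity), ← ENNReal.ofReal_mul' (by positivity), norm_mul, norm_mul]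
  refine ENNReal.ofReal_le_ofReal ?_
  calc Real.exp (-‖z‖ ^ 2 / 2) * (Real.pi⁻¹ * Real.exp (-‖w‖ ^ 2) *
        (‖bergmanKernel z w‖ * (‖g z - g w‖ * ‖φ w‖)))
      = Real.pi⁻¹ * (Real.exp (-‖z‖ ^ 2 / 2) * (‖bergmanKernel z w‖ * Real.exp (-‖w‖ ^ 2))) *
        (‖g z - g w‖ * ‖φ w‖) := by ring
    _ = Real.pi⁻¹ * (Real.exp (-‖z - w‖ ^ 2 / 2) * Real.exp (-‖w‖ ^ 2 / 2)) *
        (‖g z - g w‖ * ‖φ w‖) := by rw [norm_bergmanKernel_mul_exp]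
    _ ≤ Real.pi⁻¹ * (Real.exp (-‖z - w‖ ^ 2 / 2) * Real.exp (-‖w‖ ^ 2 / 2)) *
        ((a + b * ‖z - w‖ ^ 2) * ‖φ w‖) := by
        gcongr
        exact hg z w
    _ = _ := by
        rw [hankelKernel]
        ring

theorem enorm_sq_lp (φ : L2Gaussian) :
    ‖φ‖ₑ ^ 2 = ∫⁻ z, ‖φ z‖ₑ ^ 2 ∂gaussian := by
  rw [Lp.enorm_def, eLpNorm_eq_lintegral_rpow_enorm_toReal (by norm_num) (by norm_num),
    ← ENNReal.rpow_natCast, ← ENNReal.rpow_mul]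
  norm_num

/-- Multiplication by `exp(-|z|²/2)` carries the Gaussian `L²` norm to the Lebesgue one, up to a
factor `π⁻¹` in the squares that is common to both sides. There the operator is dominated by a
convolution, and Young's inequality bounds it by the integral of the kernel. -/
theorem norm_mulOp_sub_proj_le (g : BoundedBorel) {a b : ℝ} (ha : 0 ≤ a) (hb : 0 ≤ b)
    (hg : ∀ z w, ‖g z - g w‖ ≤ a + b * ‖z - w‖ ^ 2) (φ : fock) :
    ‖(mulOp g φ - proj (mulOp g φ) : L2Gaussian)‖ ≤ (∫ u, hankelKernel a b u) * ‖φ‖ := by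
  set h : L2Gaussian := mulOp g φ - proj (mulOp g φ) with hh
  have hφ : Measurable (φ : L2Gaussian) := (Lp.stronglyMeasurable (φ : L2Gaussian)).measurable
  set κ : ℂ → ENNReal := fun u => ENNReal.ofReal (hankelKernel a b u) with hκd
  set Φ : ℂ → ENNReal := fun w =>
    ENNReal.ofReal (Real.exp (-‖w‖ ^ 2 / 2)) * ‖(φ : L2Gaussian) w‖ₑ with hΦd
  have hκ : Measurable κ := (continuous_hankelKernel a b).measurable.ennreal_ofReal
  have hΦ : Measurable Φ := by fun_prop
  have hE : ∀ z : ℂ, ENNReal.ofReal (Real.exp (-‖z‖ ^ 2)) =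
      ENNReal.ofReal (Real.exp (-‖z‖ ^ 2 / 2)) ^ 2 := fun z => by
    rw [← ENNReal.ofReal_pow (by positivity), ← Real.exp_nat_mul]
    congr 2
    push_cast
    ring
  have hgs : ∀ ψ : ℂ → ℂ, Measurable ψ → ∫⁻ z, ‖ψ z‖ₑ ^ 2 ∂gaussian =
      ENNReal.ofReal Real.pi⁻¹ *
        ∫⁻ z, (ENNReal.ofReal (Real.exp (-‖z‖ ^ 2 / 2)) * ‖ψ z‖ₑ) ^ 2 := fun ψ hψ => by
    rw [lintegral_gaussian (by fun_prop), ← lintegral_const_mul _ (by fun_prop)]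
    congr 1 with z
    rw [ENNReal.ofReal_mul (by positivity), hE, mul_pow, mul_assoc]
  have hint : ∫⁻ u, κ u = ENNReal.ofReal (∫ u, hankelKernel a b u) :=
    (ofReal_integral_eq_lintegral_ofReal (integrable_hankelKernel a b)
      (ae_of_all _ (hankelKernel_nonneg ha hb))).symm
  have hI : 0 ≤ ∫ u, hankelKernel a b u := integral_nonneg (hankelKernel_nonneg ha hb)
  set ψ : ℂ → ℂ := fun z =>
    ∫ w, bergmanKernel z w * ((g z - g w) * (φ : L2Gaussian) w) ∂gaussian with hψd
  -- The integral formula holds only almost everywhere; this measurable representative replaces `h`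
  -- so that the pointwise kernel bound applies at every `z`.
  have hψ : StronglyMeasurable ψ := by
    refine StronglyMeasurable.integral_prod_right' (f := fun p : ℂ × ℂ =>
      bergmanKernel p.1 p.2 * ((g p.1 - g p.2) * (φ : L2Gaussian) p.2)) ?_
    have hk : Continuous fun p : ℂ × ℂ => bergmanKernel p.1 p.2 := by
      unfold bergmanKernel
      fun_prop
    exact (hk.measurable.mul (((g.measurable.comp measurable_fst).sub
      (g.measurable.comp measurable_snd)).mul (hφ.comp measurable_snd))).stronglyMeasurable
  have key : ‖h‖ₑ ^ 2 ≤ (ENNReal.ofReal (∫ u, hankelKernel a b u) * ‖φ‖ₑ) ^ 2 := by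
    have hae : ∫⁻ z, ‖h z‖ₑ ^ 2 ∂gaussian = ∫⁻ z, ‖ψ z‖ₑ ^ 2 ∂gaussian := by
      refine lintegral_congr_ae ?_
      filter_upwards [mulOp_sub_proj_ae g φ] with z hz
      rw [hz]
    have hφe : ‖φ‖ₑ ^ 2 = ∫⁻ z, ‖(φ : L2Gaussian) z‖ₑ ^ 2 ∂gaussian := enorm_sq_lp _
    rw [enorm_sq_lp, hae, hgs ψ hψ.measurable, mul_pow, hφe, hgs _ hφ, ← hint, mul_left_comm]
    refine mul_le_mul_right ((lintegral_mono fun z => ?_).trans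
      (lintegral_convolution_sq_le volume hκ hΦ)) _
    exact pow_le_pow_left' (enorm_bergman_integral_le g hg hφ z) 2
  have key2 := (ENNReal.pow_le_pow_left_iff two_ne_zero).1 key
  rw [← ofReal_norm, ← ofReal_norm, ← ENNReal.ofReal_mul hI,
    ENNReal.ofReal_le_ofReal_iff (by positivity)] at key2
  exact key2

/-- The defect is `P f (1 - P) g`: `f` enters only through its sup norm and `g` only through its
oscillation. -/
theorem norm_compress_mul_sub_le (f g fg : BoundedBorel) (hfg : ∀ z, fg z = f z * g z)
    {C a b : ℝ} (hC : ∀ z, ‖f z‖ ≤ C) (ha : 0 ≤ a) (hb : 0 ≤ b)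
    (hg : ∀ z w, ‖g z - g w‖ ≤ a + b * ‖z - w‖ ^ 2) :
    ‖compress fg - compress f * compress g‖ ≤ C * ∫ u, hankelKernel a b u := by
  have hC0 : 0 ≤ C := (norm_nonneg _).trans (hC 0)
  have hI : 0 ≤ ∫ u, hankelKernel a b u := integral_nonneg (hankelKernel_nonneg ha hb)
  refine ContinuousLinearMap.opNorm_le_bound _ (mul_nonneg hC0 hI) fun φ => ?_
  have hmul : mulOp fg φ = mulOp f (mulOp g φ) := by
    refine Lp.ext ?_
    filter_upwards [coeFn_mulOp fg φ, coeFn_mulOp f (mulOp g φ), coeFn_mulOp g φ] with z h1 h2 h3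
    rw [h1, h2, h3, hfg, mul_assoc]
  have h : (compress fg - compress f * compress g) φ =
      proj (mulOp f (mulOp g φ - proj (mulOp g φ))) := by
    rw [map_sub, map_sub, ← hmul]
    rfl
  rw [h, mul_assoc]
  refine (norm_proj_le _).trans ((norm_mulOp_le f hC _).trans ?_)
  gcongr
  exact norm_mulOp_sub_proj_le g ha hb hg φ

/-! ### The asymptotic morphism -/

theorem abs_sqrt_one_add_sq_sub_le (a b : ℝ) :
    |√(1 + a ^ 2) - √(1 + b ^ 2)| ≤ |a - b| := by
  have key : ∀ a b : ℝ, √(1 + b ^ 2) ≤ √(1 + a ^ 2) + |a - b| := fun a b => by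
    refine Real.sqrt_le_iff.2 ⟨by positivity, ?_⟩
    have hs : √(1 + a ^ 2) ^ 2 = 1 + a ^ 2 := Real.sq_sqrt (by positivity)
    have ha : |a| ≤ √(1 + a ^ 2) := Real.abs_le_sqrt (by linarith)
    -- Controls the cross term after squaring, where `b² = a² + 2 a (b - a) + (b - a)²`.
    have h1 : a * (b - a) ≤ √(1 + a ^ 2) * |a - b| := by
      rw [abs_sub_comm]
      exact (le_abs_self _).trans ((abs_mul _ _).trans_le (by gcongr))
    nlinarith [sq_abs (a - b)]
  rw [abs_sub_le_iff]
  constructor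
  · linarith [key b a, abs_sub_comm a b]
  · linarith [key a b]

/-- With `s`, `t` the two normalizing roots, `z/s - w/t = (z - w)/s + (1/s - 1/t) w`. Each term is
at most `|z - w|/s`, the second because the root is 1-Lipschitz and `|w| ≤ t`. The decay in `|z|` is
what later beats the growth of `|s z - t z|` under dilation. -/
theorem dist_radialEmbedding_le (z w : ℂ) :
    dist (radialEmbedding z) (radialEmbedding w) ≤ 2 * ‖z - w‖ / √(1 + ‖z‖ ^ 2) := by
  set s := √(1 + ‖z‖ ^ 2) with hs
  set t := √(1 + ‖w‖ ^ 2) with ht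
  have hs0 : 0 < s := Real.sqrt_pos.2 (by positivity)
  have ht0 : 0 < t := Real.sqrt_pos.2 (by positivity)
  have hwt : ‖w‖ ≤ t := Real.le_sqrt_of_sq_le (by linarith)
  have hst : |t - s| ≤ ‖z - w‖ := by
    refine (abs_sqrt_one_add_sq_sub_le _ _).trans ?_
    rw [abs_sub_comm]
    exact abs_norm_sub_norm_le z w
  have hd : (s⁻¹ • z - t⁻¹ • w : ℂ) = s⁻¹ • (z - w) + ((t - s) * s⁻¹ * t⁻¹) • w := by
    have h : (t - s) * s⁻¹ * t⁻¹ = s⁻¹ - t⁻¹ := by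
      field_simp
    rw [h, smul_sub, sub_smul]
    abel
  have hv : ∀ z : ℂ, (radialEmbedding z : ℂ) = (√(1 + ‖z‖ ^ 2))⁻¹ • z := fun z =>
    Homeomorph.unitBall_apply_coe z
  rw [Subtype.dist_eq, dist_eq_norm, hv, hv, hd]
  refine (norm_add_le _ _).trans ?_
  rw [norm_smul, norm_smul, norm_mul, norm_mul, norm_inv, norm_inv, Real.norm_of_nonneg hs0.le,
    Real.norm_of_nonneg ht0.le, Real.norm_eq_abs]
  have h1 : |t - s| * s⁻¹ * t⁻¹ * ‖w‖ ≤ ‖z - w‖ * s⁻¹ := by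
    have h2 : t⁻¹ * ‖w‖ ≤ 1 := by
      rw [inv_mul_le_iff₀ ht0]
      linarith
    calc |t - s| * s⁻¹ * t⁻¹ * ‖w‖ = |t - s| * s⁻¹ * (t⁻¹ * ‖w‖) := by ring
      _ ≤ ‖z - w‖ * s⁻¹ * 1 := by gcongr
      _ = _ := mul_one _
  calc s⁻¹ * ‖z - w‖ + |t - s| * s⁻¹ * t⁻¹ * ‖w‖ ≤ s⁻¹ * ‖z - w‖ + ‖z - w‖ * s⁻¹ := by gcongr
    _ = _ := by ring

theorem dist_radialEmbedding_le_two_mul (z w : ℂ) :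
    dist (radialEmbedding z) (radialEmbedding w) ≤ 2 * ‖z - w‖ := by
  refine (dist_radialEmbedding_le z w).trans (div_le_self (by positivity) ?_)
  exact Real.one_le_sqrt.2 (by linarith [sq_nonneg ‖z‖])

/-- The factor `|z|` in `|s z - t z|` cancels against `s |z| ≤ √(1 + |s z|²)`, so the bound is
uniform in `z`. -/
theorem dist_radialEmbedding_dilate_le {s : ℝ} (hs : 0 < s) (t : ℝ) (z : ℂ) :
    dist (radialEmbedding (s * z)) (radialEmbedding (t * z)) ≤ 2 * |s - t| / s := by
  refine (dist_radialEmbedding_le _ _).trans ?_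
  have h0 : 0 < √(1 + ‖(s : ℂ) * z‖ ^ 2) := Real.sqrt_pos.2 (by positivity)
  have h1 : s * ‖z‖ ≤ √(1 + ‖(s : ℂ) * z‖ ^ 2) := by
    refine Real.le_sqrt_of_sq_le ?_
    rw [norm_mul, Complex.norm_real, Real.norm_of_nonneg hs.le]
    linarith
  rw [← sub_mul, norm_mul, ← Complex.ofReal_sub, Complex.norm_real, Real.norm_eq_abs,
    div_le_div_iff₀ h0 hs]
  calc 2 * (|s - t| * ‖z‖) * s = 2 * |s - t| * (s * ‖z‖) := by ring
    _ ≤ _ := by gcongr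

theorem continuousOn_wickQuantization (f : C(RadialCompactification, ℂ)) :
    ContinuousOn (fun ħ => wickQuantization ħ f) (Set.Ioi (0 : ℝ)) := by
  refine fun s hs => ContinuousAt.continuousWithinAt ?_
  have hs : 0 < s := hs
  refine (Metric.continuousAt_iff (β := fock →L[ℂ] fock)).2 fun ε hε => ?_
  obtain ⟨δ, hδ, hf⟩ := Metric.uniformContinuous_iff.1
    (CompactSpace.uniformContinuous_of_continuous f.continuous) (ε / 2) (half_pos hε)
  -- Chosen so that the uniform bound `2 |s - t| / s` falls below `δ`.
  refine ⟨δ * s / 2, by positivity, fun {t} ht => ?_⟩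
  refine ((dist_comm _ _).trans (dist_eq_norm (E := fock →L[ℂ] fock) _ _)).trans_lt ?_
  rw [wickQuantization_apply, wickQuantization_apply]
  refine (norm_compress_sub_le _ _ fun z => ?_).trans_lt (half_lt_self hε)
  rw [← dist_eq_norm]
  refine (hf ((dist_radialEmbedding_dilate_le hs t z).trans_lt ?_)).le
  rw [dist_comm, Real.dist_eq] at ht
  rw [div_lt_iff₀ hs]
  linarith

/-- Points whose images are `δ`-close contribute at most `η`. Otherwise the Lipschitz bound forces
`1 ≤ (2 |ħ| |z - w| / δ)²`, and the trivial bound `2 ‖g‖` may be multiplied by this quantity; hence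
the constant `8 = 2 · 2²`. -/
theorem norm_dilate_restrict_sub_le (g : C(RadialCompactification, ℂ)) {η δ : ℝ} (hη : 0 ≤ η)
    (hδ : 0 < δ) (hg : ∀ ⦃p q : RadialCompactification⦄, dist p q < δ → dist (g p) (g q) < η)
    (ħ : ℝ) (z w : ℂ) :
    ‖dilate ħ (restrict g) z - dilate ħ (restrict g) w‖ ≤
      η + 8 * ‖g‖ * ħ ^ 2 / δ ^ 2 * ‖z - w‖ ^ 2 := by
  rw [← dist_eq_norm]
  change dist (g (radialEmbedding (ħ * z))) (g (radialEmbedding (ħ * w))) ≤ _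
  rcases lt_or_ge (dist (radialEmbedding (ħ * z)) (radialEmbedding (ħ * w))) δ with h | h
  · exact (hg h).le.trans (le_add_of_nonneg_right (by positivity))
  · have h1 := h.trans (dist_radialEmbedding_le_two_mul _ _)
    rw [← mul_sub, norm_mul, Complex.norm_real, Real.norm_eq_abs] at h1
    have h2 : 1 ≤ (2 * (|ħ| * ‖z - w‖)) ^ 2 / δ ^ 2 := by
      rw [one_le_div₀ (by positivity)]
      gcongr
    calc dist (g (radialEmbedding (ħ * z))) (g (radialEmbedding (ħ * w))) ≤ ‖g‖ + ‖g‖ :=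
          (dist_le_norm_add_norm _ _).trans
            (add_le_add (g.norm_coe_le_norm _) (g.norm_coe_le_norm _))
      _ = 2 * ‖g‖ * 1 := by ring
      _ ≤ 2 * ‖g‖ * ((2 * (|ħ| * ‖z - w‖)) ^ 2 / δ ^ 2) := by gcongr
      _ = 8 * ‖g‖ * ħ ^ 2 / δ ^ 2 * ‖z - w‖ ^ 2 := by
        rw [mul_pow, mul_pow, sq_abs]
        ring
      _ ≤ _ := le_add_of_nonneg_left hη

theorem tendsto_wickQuantization_mul (f g : C(RadialCompactification, ℂ)) :
    Tendsto (fun ħ => ‖wickQuantization ħ (f * g) - wickQuantization ħ f * wickQuantization ħ g‖)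
      (𝓝[>] (0 : ℝ)) (𝓝 0) := by
  set I₀ : ℝ := ∫ u, hankelKernel 1 0 u with hI₀
  set I₁ : ℝ := ∫ u, hankelKernel 0 1 u with hI₁
  have h0 : 0 ≤ I₀ := integral_nonneg (hankelKernel_nonneg zero_le_one le_rfl)
  rw [Metric.tendsto_nhds]
  intro ε hε
  -- The summand `1` keeps the denominator positive and leaves strict room: `‖f‖ η I₀ = ε - η < ε`,
  -- which the `ħ²` term may use up.
  set η : ℝ := ε / (‖f‖ * I₀ + 1) with hη
  have hη0 : 0 < η := by positivity
  obtain ⟨δ, hδ, hg⟩ := Metric.uniformContinuous_iff.1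
    (CompactSpace.uniformContinuous_of_continuous g.continuous) η hη0
  have hlim : Tendsto (fun ħ : ℝ => ‖f‖ * (η * I₀ + 8 * ‖g‖ * ħ ^ 2 / δ ^ 2 * I₁)) (𝓝[>] 0)
      (𝓝 (‖f‖ * (η * I₀ + 8 * ‖g‖ * 0 ^ 2 / δ ^ 2 * I₁))) := by
    have hc : Continuous fun ħ : ℝ => ‖f‖ * (η * I₀ + 8 * ‖g‖ * ħ ^ 2 / δ ^ 2 * I₁) := by fun_prop
    exact (hc.tendsto 0).mono_left nhdsWithin_le_nhds
  have hlt : ‖f‖ * (η * I₀ + 8 * ‖g‖ * 0 ^ 2 / δ ^ 2 * I₁) < ε := by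
    have : η * (‖f‖ * I₀ + 1) = ε := div_mul_cancel₀ _ (by positivity)
    rw [zero_pow two_ne_zero, mul_zero, zero_div, zero_mul, add_zero, mul_left_comm]
    linarith
  filter_upwards [hlim.eventually_lt_const hlt] with ħ hħ
  rw [dist_zero_right]
  refine (Real.norm_of_nonneg (norm_nonneg (E := fock →L[ℂ] fock) _)).trans_lt (lt_of_le_of_lt ?_ hħ)
  rw [hI₀, hI₁, ← integral_hankelKernel, wickQuantization_apply, wickQuantization_apply,
    wickQuantization_apply]
  exact norm_compress_mul_sub_le _ _ _ (fun z => rfl) (fun z => f.norm_coe_le_norm _) hη0.le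
    (by positivity) (norm_dilate_restrict_sub_le g hη0.le hδ hg ħ)

theorem isRelativePositiveAsymptoticMorphism_wickQuantization :
    IsRelativePositiveAsymptoticMorphism (B := fock →L[ℂ] fock) wickQuantization
      zeroAtInfinity (compactOperators fock) where
  positive ħ _ f hf := by
    rw [wickQuantization_apply]
    exact compress_nonneg _ fun z => hf _
  continuousOn f := (continuousOn_wickQuantization f).mono fun _ h => h.1
  tendsto_mul := tendsto_wickQuantization_mul
  mem _ hħ _ hf := wickQuantization_mem hħ.1 hf

end WickToeplitz

end

theorem proposition5p5p4 :
    -- `Q^W_ħ` is a relative positive asymptotic morphism `(C(δℂ), C_0(ℂ)) → (B(F), K(F))`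
    WickToeplitz.IsRelativePositiveAsymptoticMorphism
        (B := WickToeplitz.fock →L[ℂ] WickToeplitz.fock) WickToeplitz.wickQuantization
        WickToeplitz.zeroAtInfinity (WickToeplitz.compactOperators WickToeplitz.fock) ∧
    -- `A^W_ħ` is a locally compact-valued `C_δ`-asymptotic spectral measure
    WickToeplitz.IsCompactificationASM WickToeplitz.radialEmbedding WickToeplitz.wickASM ∧
    WickToeplitz.IsLocallyValued WickToeplitz.wickASM
        (WickToeplitz.compactOperators WickToeplitz.fock) ∧
    -- `Q^W_ħ(f) = ∫ f dA^W_ħ`, and `A^W_ħ` is the only family of POVMs with this property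
    WickToeplitz.Represents WickToeplitz.radialEmbedding WickToeplitz.wickASM
        WickToeplitz.wickQuantization ∧
    (∀ A : ℝ → WickToeplitz.OpSetFun ℂ WickToeplitz.fock,
      WickToeplitz.Represents WickToeplitz.radialEmbedding A WickToeplitz.wickQuantization →
        ∀ ħ ∈ Set.Ioc (0 : ℝ) 1, ∀ (Δ : Set ℂ) (hΔ : MeasurableSet Δ),
          A ħ Δ hΔ = WickToeplitz.wickASM ħ Δ hΔ) ∧
    -- `A^W(ħ⁻¹ Δ) = P ∘ α_ħ(χ_Δ)`
    (∀ ħ ∈ Set.Ioc (0 : ℝ) 1, ∀ (Δ : Set ℂ) (hΔ : MeasurableSet Δ),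
      WickToeplitz.wickASM ħ Δ hΔ =
        WickToeplitz.compress (WickToeplitz.dilate ħ (WickToeplitz.borelIndicator Δ hΔ))) := by
  open WickToeplitz in
  exact ⟨isRelativePositiveAsymptoticMorphism_wickQuantization,
    ⟨wickQuantization, represents_wickASM,
      isRelativePositiveAsymptoticMorphism_wickQuantization.toIsPositiveAsymptoticMorphism⟩,
    isLocallyValued_wickASM, represents_wickASM,
    fun A hA ħ hħ Δ hΔ => hA.eq isOpenEmbedding_radialEmbedding.measurableEmbedding
      represents_wickASM hħ Δ hΔ,
    fun ħ hħ Δ hΔ => wickASM_eq_compress hħ.1.ne' Δ hΔ⟩
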